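/- Write $\mathrm{e}(x)=e^{2\pi i x}$. Let $(\Gamma,Q)$ be a discriminant form: a finite abelian group $\Gamma$ (written additively) with a map $Q\colon\Gamma\to\mathbb{C}^\times$ such that $Q(na)=Q(a)^{n^2}$ for all $n\in\mathbb{Z}$, $a\in\Gamma$, and $B_Q(a,b)=Q(a+b)Q(a)^{-1}Q(b)^{-1}$ is bimultiplicative and nondegenerate. *Choices.* Consider data $(\sigma,\omega,q,\delta)$ as follows. The map $\sigma\colon\Gamma\times\Gamma\to\mathbb{C}^\times$ is symmetric with $\sigma(a,0)=\sigma(0,a)=1$; the function $\omega(a,b,c)=\sigma(a,b)\sigma(a,c)\sigma(a,b+c)^{-1}$ takes values in $\{\pm1\}$ and is a homomorphism in $a$ for all fixed $b,c$ (so that $(\sigma,\omega)$ is an abelian 3-cocycle); and $\sigma(a,a)=Q(a)$, i.e. $(\sigma,\omega)$ represents $Q$. Further $q\colon\Gamma\to\mathbb{C}^\times$ and $\delta\in\Gamma$ with $2\delta=0$ satisfy $q(a)^2=Q(a)$ and $q(a+b)q(a)^{-1}q(b)^{-1}=\sigma(a,b)\,\omega(a+b,a,b)\,\omega(\delta,a,b)$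 for all $a,b\in\Gamma$. The associated partial Gauss sum is $$G_\delta(\Gamma,q^{-1})=|2\Gamma|^{-1/2}\sum_{a\in\delta+2\Gamma}q(a)^{-1}.$$ *Jordan components.* Every discriminant form is an orthogonal direct sum of indecomposable Jordan components, namely (for $k\ge1$): - $(p^k)^{\pm1}$, $p$ an odd prime: $\mathbb{Z}/p^k=\langle x\rangle$, $Q(x)=\mathrm{e}(u/p^k)$ with $u\in\mathbb{Z}$, $(u,p)=1$ and $\left(\frac{2u}{p}\right)=\pm1$; - $(2^k)_t^{\pm1}$: $\mathbb{Z}/2^k=\langle x\rangle$, $Q(x)=\mathrm{e}(t/2^{k+1})$ with $t$ an odd integer (only its class modulo $8$ is recorded) and $\left(\frac{t}{2}\right)=(-1)^{(t^2-1)/8}=\pm1$; - $(2^k)_{II}^{+2}$: $(\mathbb{Z}/2^k)^2=\langle x,y\rangle$, $Q(x)=Q(y)=1$, $B_Q(x,y)=\mathrm{e}(2^{-k})$; - $(2^k)_{II}^{-2}$: $(\mathbb{Z}/2^k)^2=\langle x,y\rangle$, $Q(x)=Q(y)=B_Q(x,y)=\mathrm{e}(2^{-k})$. The sign of a component is the sign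 in its exponent. When it is well defined, the sign $s$ of a discriminant form is the product of the signs of the components in any such decomposition. The signature $\operatorname{sign}(\Gamma)\in\mathbb{Z}/8$ is defined by $|\Gamma|^{-1/2}\sum_{a\in\Gamma}Q(a)=\mathrm{e}(\operatorname{sign}(\Gamma)/8)$. Let $\Gamma=\Gamma_{\mathrm{ev}}\oplus\Gamma_{\mathrm{odd}}$ be the decomposition into the $2$-primary part and the part of odd order. **Proposition.** Data $(\sigma,\omega,q,\delta)$ as above and Jordan decompositions of $(\Gamma,Q)$ exist. For any Jordan decomposition of $(\Gamma,Q)$, the partial Gauss sum $G_\delta(\Gamma,q^{-1})$ is well defined, i.e. independent of the choice of $(\sigma,\omega,q,\delta)$, if and only if the decomposition contains no component $2_t^{\pm1}$ (the case $k=1$ of the second type). In that case the signature of $\Gamma$ and the sign $s(\Gamma_{\mathrm{ev}})$ are well defined, and for every choice of $(\sigma,\omega,q,\delta)$ one has $\delta=0$ in $\Gamma/2\Gamma$ and $$G_\delta(\Gamma,q^{-1})=G_0(\Gamma,q^{-1})=|2\Gamma|^{-1/2}\sum_{a\in2\Gamma}q(a)^{-1}=\mathrm{e}\!\left(-\frac{\operatorname{sign}(\Gamma)}{8}\right)s(\Gamma_{\mathrm{ev}})\left(\frac{2}{|\Gamma_{\mathrm{odd}}|}\right),$$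 where $\left(\frac{2}{\cdot}\right)$ is the Kronecker (Jacobi) symbol. -/

import Mathlib

namespace DiscForm

/-- `e x = exp (2 π i x)`. -/
noncomputable def e (x : ℝ) : ℂ := Complex.exp (2 * Real.pi * Complex.I * x)

section Forms

variable {Γ : Type*} [AddCommGroup Γ]

/-- The associated form `B_Q(a,b) = Q(a+b) Q(a)⁻¹ Q(b)⁻¹`. -/
def assocForm (Q : Γ → ℂˣ) (a b : Γ) : ℂˣ := Q (a + b) * (Q a)⁻¹ * (Q b)⁻¹

/-- `Q` is a nondegenerate quadratic form, so that `(Γ, Q)` is a discriminant form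
when `Γ` is finite. -/
structure IsNondegQuadratic (Q : Γ → ℂˣ) : Prop where
  map_zsmul : ∀ (n : ℤ) (a : Γ), Q (n • a) = Q a ^ (n ^ 2)
  assoc_add_left : ∀ a b c : Γ, assocForm Q (a + b) c = assocForm Q a c * assocForm Q b c
  assoc_add_right : ∀ a b c : Γ, assocForm Q a (b + c) = assocForm Q a b * assocForm Q a c
  nondeg : ∀ a : Γ, (∀ b : Γ, assocForm Q a b = 1) → a = 0

/-- `(σ, ω)` is an abelian 3-cocycle: `ω` is a 3-cocycle and the two hexagon identities hold. -/
structure IsAbelianThreeCocycle (σ : Γ → Γ → ℂˣ) (ω : Γ → Γ → Γ → ℂˣ) : Prop where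
  cocycle : ∀ a b c d : Γ,
    ω b c d * ω a (b + c) d * ω a b c = ω (a + b) c d * ω a b (c + d)
  hexagon_left : ∀ a b c : Γ,
    ω b a c / (ω a b c * ω b c a) = σ a (b + c) / (σ a b * σ a c)
  hexagon_right : ∀ a b c : Γ,
    ω a b c * ω c a b / ω a c b = σ (a + b) c / (σ a c * σ b c)

/-- `∂σ(a; b, c) = σ(a,b) σ(a,c) σ(a,b+c)⁻¹`. -/
def bdry (σ : Γ → Γ → ℂˣ) (a b c : Γ) : ℂˣ := σ a b * σ a c * (σ a (b + c))⁻¹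

/-- `σ` is an abelian symmetric 2-cochain: normalised, symmetric, and `∂σ` takes values in
`{1, -1}` and is a homomorphism in its first argument. -/
structure IsAbelianSymmCochain (σ : Γ → Γ → ℂˣ) : Prop where
  normalised_left : ∀ a : Γ, σ 0 a = 1
  normalised_right : ∀ a : Γ, σ a 0 = 1
  symm : ∀ a b : Γ, σ a b = σ b a
  bdry_sign : ∀ a b c : Γ, bdry σ a b c = 1 ∨ bdry σ a b c = -1
  bdry_add : ∀ a a' b c : Γ, bdry σ (a + a') b c = bdry σ a b c * bdry σ a' b c

/-- The data `(σ, ω, q, δ)`: an abelian 3-cocycle `(σ, ω) = (σ, ∂σ)` representing `Q`, where `σ`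
is an abelian symmetric 2-cochain, together with an element `δ` with `2δ = 0` and a function `q`
that is a square root of `Q` in the sense of the last two fields. -/
structure GaussDatum (Q : Γ → ℂˣ) where
  σ : Γ → Γ → ℂˣ
  ω : Γ → Γ → Γ → ℂˣ
  q : Γ → ℂˣ
  δ : Γ
  isCocycle : IsAbelianThreeCocycle σ ω
  isCochain : IsAbelianSymmCochain σ
  omega_eq : ω = bdry σ
  sigma_diag : ∀ a : Γ, σ a a = Q a
  two_delta : 2 • δ = 0
  q_sq : ∀ a : Γ, q a ^ 2 = Q a
  q_add : ∀ a b : Γ, q (a + b) * (q a)⁻¹ * (q b)⁻¹ = σ a b * ω (a + b) a b * ω δ a b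

variable (Γ) in
/-- The subgroup `2Γ`. -/
def twoMul : AddSubgroup Γ := (nsmulAddMonoidHom (α := Γ) 2).range

open Classical in
/-- The partial Gauss sum `|2Γ|^{-1/2} ∑_{a ∈ δ} q(a)⁻¹` over a coset `δ` in `Γ / 2Γ`. -/
noncomputable def partialGaussSum [Fintype Γ] (q : Γ → ℂˣ) (δ : Γ ⧸ twoMul Γ) : ℂ :=
  ((√(Nat.card (twoMul Γ) : ℝ) : ℝ) : ℂ)⁻¹ *
    ∑ a with (QuotientAddGroup.mk a : Γ ⧸ twoMul Γ) = δ, ((q a : ℂˣ) : ℂ)⁻¹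

/-- The partial Gauss sum of the data `(σ, ω, q, δ)`. -/
noncomputable def GaussDatum.gaussSum [Fintype Γ] {Q : Γ → ℂˣ} (c : GaussDatum Q) : ℂ :=
  partialGaussSum c.q (QuotientAddGroup.mk c.δ)

/-- `r ∈ ℤ/8` is the signature of `(Γ, Q)`: `|Γ|^{-1/2} ∑_{a ∈ Γ} Q(a) = e(r/8)`. -/
def IsSignature [Fintype Γ] (Q : Γ → ℂˣ) (r : ZMod 8) : Prop :=
  ((√(Nat.card Γ : ℝ) : ℝ) : ℂ)⁻¹ * ∑ a : Γ, ((Q a : ℂˣ) : ℂ) = e ((r.val : ℝ) / 8)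

variable (Γ) in
/-- The 2-primary part of `Γ`. -/
def evenPart : AddSubgroup Γ where
  carrier := {a | ∃ k : ℕ, 2 ^ k • a = 0}
  zero_mem' := ⟨0, smul_zero _⟩
  add_mem' := by
    rintro a b ⟨k, hk⟩ ⟨l, hl⟩
    refine ⟨k + l, ?_⟩
    rw [smul_add, pow_add, mul_comm, mul_smul, hk, mul_comm, mul_smul, hl]
    simp
  neg_mem' := by
    rintro a ⟨k, hk⟩
    exact ⟨k, by rw [smul_neg, hk, neg_zero]⟩

variable (Γ) in
/-- The elements of odd order, i.e. the sum of the `p`-primary parts over all odd primes `p`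
when `Γ` is finite. -/
def oddPart : AddSubgroup Γ where
  carrier := {a | ∃ n : ℕ, Odd n ∧ n • a = 0}
  zero_mem' := ⟨1, odd_one, smul_zero _⟩
  add_mem' := by
    rintro a b ⟨m, hm, ha⟩ ⟨n, hn, hb⟩
    refine ⟨m * n, hm.mul hn, ?_⟩
    rw [smul_add, mul_comm, mul_smul, ha, mul_comm, mul_smul, hb]
    simp
  neg_mem' := by
    rintro a ⟨n, hn, ha⟩
    exact ⟨n, hn, by rw [smul_neg, ha, neg_zero]⟩

end Forms

/-- The symbols of the indecomposable Jordan components: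
`odd p k ε` is `(p^k)^{ε1}` for an odd prime `p`, `two k t ε` is `(2^k)_t^{ε1}` with `t ∈ ℤ/8`, and
`twoII k ε` is `(2^k)_{II}^{ε2}`. -/
inductive JordanSymbol where
  | odd (p k : ℕ) (ε : ℤˣ)
  | two (k : ℕ) (t : ZMod 8) (ε : ℤˣ)
  | twoII (k : ℕ) (ε : ℤˣ)

namespace JordanSymbol

/-- The sign in the exponent. -/
def sign : JordanSymbol → ℤˣ
  | odd _ _ ε => ε
  | two _ _ ε => ε
  | twoII _ ε => ε

/-- The symbol is `2_t^{±1}` for some `t`. -/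
def IsTwoT : JordanSymbol → Prop
  | two k _ _ => k = 1
  | _ => False

/-- `(D, Q)` is the indecomposable discriminant form with the given symbol. -/
def Describes {D : Type*} [AddCommGroup D] (Q : D → ℂˣ) : JordanSymbol → Prop
  | odd p k ε => p.Prime ∧ p ≠ 2 ∧ 0 < k ∧ ∃ f : ZMod (p ^ k) ≃+ D, ∃ u : ℤ,
      IsCoprime u (p : ℤ) ∧ jacobiSym (2 * u) p = (ε : ℤ) ∧
      ((Q (f 1) : ℂˣ) : ℂ) = e ((u : ℝ) / (p : ℝ) ^ k)
  | two k t ε => 0 < k ∧ ZMod.χ₈ t = (ε : ℤ) ∧ ∃ f : ZMod (2 ^ k) ≃+ D, ∃ u : ℤ,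
      (u : ZMod 8) = t ∧ ((Q (f 1) : ℂˣ) : ℂ) = e ((u : ℝ) / 2 ^ (k + 1))
  | twoII k ε => 0 < k ∧ ∃ f : (ZMod (2 ^ k) × ZMod (2 ^ k)) ≃+ D,
      ((assocForm Q (f (1, 0)) (f (0, 1)) : ℂˣ) : ℂ) = e (1 / 2 ^ k) ∧
      (ε = 1 → Q (f (1, 0)) = 1 ∧ Q (f (0, 1)) = 1) ∧
      (ε = -1 → ((Q (f (1, 0)) : ℂˣ) : ℂ) = e (1 / 2 ^ k) ∧
        ((Q (f (0, 1)) : ℂˣ) : ℂ) = e (1 / 2 ^ k))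

end JordanSymbol

/-- A decomposition of `(Γ, Q)` as an orthogonal direct sum of finitely many indecomposable Jordan
components. -/
structure JordanDecomposition {Γ : Type*} [AddCommGroup Γ] (Q : Γ → ℂˣ) where
  n : ℕ
  component : Fin n → AddSubgroup Γ
  symbol : Fin n → JordanSymbol
  isInternal : DirectSum.IsInternal component
  orthogonal : ∀ i j : Fin n, i ≠ j →
    ∀ a ∈ component i, ∀ b ∈ component j, assocForm Q a b = 1
  describes : ∀ i : Fin n, (symbol i).Describes (fun a : component i => Q a)

namespace JordanDecomposition

variable {Γ : Type*} [AddCommGroup Γ] {Q : Γ → ℂˣ}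

/-- Some component of the decomposition is of type `2_t^{±1}`. -/
def ContainsTwoT (d : JordanDecomposition Q) : Prop := ∃ i, (d.symbol i).IsTwoT

/-- The product of the signs of the components. -/
def sign (d : JordanDecomposition Q) : ℤˣ := ∏ i, (d.symbol i).sign

end JordanDecomposition

/-- `s` is the well-defined sign of `(Γ, Q)`: Jordan decompositions exist, and each of them has
sign `s`. -/
def IsSign {Γ : Type*} [AddCommGroup Γ] (Q : Γ → ℂˣ) (s : ℤˣ) : Prop :=
  Nonempty (JordanDecomposition Q) ∧ ∀ d : JordanDecomposition Q, d.sign = s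

end DiscForm

namespace DiscForm

/-! The engine is the identity `GaussDatum.q_delta_add`: q(δ+2a) = q(δ) Q(a)² B(δ,a), in which all
signs ω cancel. It turns the partial sum into q(δ)⁻¹ |2Γ|^{-1/2} |Γ[2]|⁻¹ times a sum over Γ of the
inverse of F(a) = Q(a)² B(δ,a). Taking 2a = 0 gives Q² B(δ,·) = 1 on Γ[2]. As the associated form of
F is B², with radical Γ[2], F is trivial on its radical, so the sum never vanishes
(`gaussSum_ne_zero`).

Everything therefore depends on whether Q² is trivial on Γ[2], which is the intrinsic meaning of
having no component 2_t. If Q(x)² ≠ 1 for some x in Γ[2], then multiplying q by the character B(x,·)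
gives new data and changes the nonzero sum by the factor B(x,δ)⁻¹ ≠ 1 (`exists_gaussSum_ne`). If Q²
= 1 on Γ[2], then δ is orthogonal to Γ[2], hence lies in 2Γ, and the partial sum is a normalised sum
of Q⁻², independent of all choices.

To evaluate it, compare the sum of Q² with the sum of Q. On each admissible component their ratio is
a positive real times a sign: (2/p^k) for odd p (`sum_pow_two_mul_sq_prime_pow`), the sign of the
component for p = 2 (`cyclicSum_sq`, `binarySum_sq`). The positive factors need not be tracked,
since absolute values determine them. As the sum of Q is nonzero, the sign of the ratio is an
invariant of the form, so the sign of the even part is well defined.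

The signature exists because the Gauss sum G of Q satisfies G·Ḡ = |Γ| and G⁴ = Ḡ⁴; the latter comes
from a quaternion acting on Γ⁴ with norm -1 (`sum_pow_four_eq`). Jordan decompositions exist by
splitting off nondegenerate blocks of maximal exponent. Data exist because on each component Q lifts
to a lattice, where it has a quadratic square root r; a section of the lattice then produces σ and q
(`GaussDatum.nonempty_of_lift`). -/

/-- A possibly degenerate quadratic form with values in `ℂˣ`. -/
structure IsQuadratic {A : Type*} [AddCommGroup A] (Q : A → ℂˣ) : Prop where
  map_zsmul : ∀ (n : ℤ) (a : A), Q (n • a) = Q a ^ (n ^ 2)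
  assoc_add_left : ∀ a b c : A, assocForm Q (a + b) c = assocForm Q a c * assocForm Q b c

/-! ### Quadratic forms, nondegeneracy and duality. -/

section Basic

variable {A : Type*} [AddCommGroup A] {Q : A → ℂˣ}

theorem IsNondegQuadratic.isQuadratic (h : IsNondegQuadratic Q) : IsQuadratic Q :=
  ⟨h.map_zsmul, h.assoc_add_left⟩

theorem assocForm_comm (Q : A → ℂˣ) (a b : A) : assocForm Q a b = assocForm Q b a := by
  simp only [assocForm, add_comm a b, mul_assoc, mul_comm (Q a)⁻¹]

theorem map_add_eq (Q : A → ℂˣ) (a b : A) : Q (a + b) = Q a * Q b * assocForm Q a b := by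
  rw [assocForm, mul_assoc (Q (a + b)), ← mul_inv, mul_inv_cancel_comm_assoc]

namespace IsQuadratic

theorem map_zero (h : IsQuadratic Q) : Q 0 = 1 := by
  simpa using h.map_zsmul 0 0

theorem assoc_add_right (h : IsQuadratic Q) (a b c : A) :
    assocForm Q a (b + c) = assocForm Q a b * assocForm Q a c := by
  rw [assocForm_comm, h.assoc_add_left, assocForm_comm Q b, assocForm_comm Q c]

/-- The associated form as a homomorphism in its second argument. -/
def pairing (h : IsQuadratic Q) (a : A) : A →+ Additive ℂˣ :=
  AddMonoidHom.mk' (fun b => Additive.ofMul (assocForm Q a b)) fun b c => by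
    simp [h.assoc_add_right]

theorem pairing_apply (h : IsQuadratic Q) (a b : A) :
    (h.pairing a b).toMul = assocForm Q a b := rfl

theorem assoc_zero_right (h : IsQuadratic Q) (a : A) : assocForm Q a 0 = 1 :=
  congrArg Additive.toMul (_root_.map_zero (h.pairing a))

theorem assoc_zero_left (h : IsQuadratic Q) (a : A) : assocForm Q 0 a = 1 := by
  rw [assocForm_comm, h.assoc_zero_right]

theorem assoc_zsmul_right (h : IsQuadratic Q) (n : ℤ) (a b : A) :
    assocForm Q a (n • b) = assocForm Q a b ^ n :=
  congrArg Additive.toMul (_root_.map_zsmul (h.pairing a) n b)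

theorem assoc_zsmul_left (h : IsQuadratic Q) (n : ℤ) (a b : A) :
    assocForm Q (n • a) b = assocForm Q a b ^ n := by
  rw [assocForm_comm, h.assoc_zsmul_right, assocForm_comm]

theorem assoc_nsmul_right (h : IsQuadratic Q) (n : ℕ) (a b : A) :
    assocForm Q a (n • b) = assocForm Q a b ^ n := by
  simpa using h.assoc_zsmul_right n a b

theorem assoc_nsmul_left (h : IsQuadratic Q) (n : ℕ) (a b : A) :
    assocForm Q (n • a) b = assocForm Q a b ^ n := by
  simpa using h.assoc_zsmul_left n a b

theorem assoc_neg_right (h : IsQuadratic Q) (a b : A) :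
    assocForm Q a (-b) = (assocForm Q a b)⁻¹ := by
  simpa using h.assoc_zsmul_right (-1) a b

theorem assoc_neg_left (h : IsQuadratic Q) (a b : A) :
    assocForm Q (-a) b = (assocForm Q a b)⁻¹ := by
  simpa using h.assoc_zsmul_left (-1) a b

theorem assoc_sub_left (h : IsQuadratic Q) (a b c : A) :
    assocForm Q (a - b) c = assocForm Q a c * (assocForm Q b c)⁻¹ := by
  rw [sub_eq_add_neg, h.assoc_add_left, h.assoc_neg_left]

theorem map_nsmul (h : IsQuadratic Q) (n : ℕ) (a : A) : Q (n • a) = Q a ^ (n ^ 2) := by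
  have := h.map_zsmul n a
  rw [natCast_zsmul] at this
  rw [this]; exact_mod_cast rfl

theorem assoc_self (h : IsQuadratic Q) (a : A) : assocForm Q a a = Q a ^ 2 := by
  have h2 := h.map_nsmul 2 a
  rw [two_nsmul] at h2
  rw [assocForm, h2]
  group

theorem map_linearComb (h : IsQuadratic Q) (m n : ℤ) (x y : A) :
    Q (m • x + n • y) = Q x ^ (m ^ 2) * Q y ^ (n ^ 2) * assocForm Q x y ^ (m * n) := by
  rw [map_add_eq Q, h.map_zsmul, h.map_zsmul, h.assoc_zsmul_left, h.assoc_zsmul_right,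
    ← zpow_mul, mul_comm m n]

theorem comp (h : IsQuadratic Q) {A' : Type*} [AddCommGroup A'] (f : A' →+ A) :
    IsQuadratic (fun a => Q (f a)) where
  map_zsmul n a := by rw [_root_.map_zsmul, h.map_zsmul]
  assoc_add_left a b c := by
    have := h.assoc_add_left (f a) (f b) (f c)
    simpa only [assocForm, _root_.map_add] using this

theorem restrict (h : IsQuadratic Q) (H : AddSubgroup A) : IsQuadratic (fun a : H => Q a) :=
  h.comp H.subtype

theorem pow_card_sq [Finite A] (h : IsQuadratic Q) (a : A) : Q a ^ (Nat.card A) ^ 2 = 1 := by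
  rw [← h.map_nsmul, card_nsmul_eq_zero', h.map_zero]

theorem norm_eq_one [Finite A] (h : IsQuadratic Q) (a : A) : ‖(Q a : ℂ)‖ = 1 := by
  refine Complex.norm_eq_one_of_pow_eq_one (n := Nat.card A ^ 2) ?_
    (pow_ne_zero _ Nat.card_pos.ne')
  rw [← Units.val_pow_eq_pow_val, h.pow_card_sq, Units.val_one]

theorem inv_eq_conj [Finite A] (h : IsQuadratic Q) (a : A) :
    (Q a : ℂ)⁻¹ = starRingEnd ℂ (Q a : ℂ) :=
  Complex.inv_eq_conj (h.norm_eq_one a)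

end IsQuadratic

/-- Nondegeneracy of `Q` on the subgroup `H`. -/
def NondegOn (Q : A → ℂˣ) (H : AddSubgroup A) : Prop :=
  ∀ a ∈ H, (∀ b ∈ H, assocForm Q a b = 1) → a = 0

theorem NondegOn.isNondegQuadratic {H : AddSubgroup A} (hQ : IsQuadratic Q)
    (h : NondegOn Q H) : IsNondegQuadratic (fun a : H => Q a) where
  map_zsmul := (hQ.restrict H).map_zsmul
  assoc_add_left := (hQ.restrict H).assoc_add_left
  assoc_add_right := (hQ.restrict H).assoc_add_right
  nondeg a ha := Subtype.ext (h a a.2 fun b hb => ha ⟨b, hb⟩)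

theorem IsNondegQuadratic.nondegOn_top (h : IsNondegQuadratic Q) : NondegOn Q ⊤ :=
  fun a _ ha => h.nondeg a fun b => ha b trivial

/-- Every character of a finite group with a nondegenerate form is given by an element. -/
theorem IsNondegQuadratic.exists_eq_pairing [Finite A] (h : IsNondegQuadratic Q)
    (χ : A →+ Additive ℂˣ) : ∃ a, h.isQuadratic.pairing a = χ := by
  have hinj : Function.Injective (fun a => AddMonoidHom.toMultiplicativeLeft
      (h.isQuadratic.pairing a)) := by
    intro a b hab
    have hab' : h.isQuadratic.pairing a = h.isQuadratic.pairing b :=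
      AddMonoidHom.toMultiplicativeLeft.injective hab
    rw [← sub_eq_zero]
    refine h.nondeg _ fun c => ?_
    rw [h.isQuadratic.assoc_sub_left, mul_inv_eq_one]
    exact congrArg Additive.toMul (DFunLike.congr_fun hab' c)
  -- A finite abelian group and its character group have the same order, so injectivity suffices.
  have hcard := CommGroup.card_monoidHom_of_hasEnoughRootsOfUnity (Multiplicative A) ℂ
  have hbij := (Nat.bijective_iff_injective_and_card _).2 ⟨hinj, hcard.symm⟩
  obtain ⟨a, ha⟩ := hbij.2 (AddMonoidHom.toMultiplicativeLeft χ)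
  exact ⟨a, AddMonoidHom.toMultiplicativeLeft.injective ha⟩

/-- If `Q` is nondegenerate on `H`, every element is congruent to an element of `H` modulo the
orthogonal complement of `H`. -/
theorem NondegOn.exists_sub_orthogonal {H : AddSubgroup A} [Finite H] (hQ : IsQuadratic Q)
    (h : NondegOn Q H) (a : A) : ∃ x ∈ H, ∀ b ∈ H, assocForm Q (a - x) b = 1 := by
  obtain ⟨x, hx⟩ := (h.isNondegQuadratic hQ).exists_eq_pairing ((hQ.pairing a).comp H.subtype)
  refine ⟨x, x.2, fun b hb => ?_⟩
  rw [hQ.assoc_sub_left, mul_inv_eq_one]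
  exact (congrArg Additive.toMul (DFunLike.congr_fun hx ⟨b, hb⟩)).symm

/-- Double orthogonal complement: characters trivial on H separate the elements outside H, and every
character is some B(y,·). -/
theorem IsNondegQuadratic.mem_of_orthogonal [Finite A] (h : IsNondegQuadratic Q)
    (H : AddSubgroup A) (a : A)
    (ha : ∀ y, (∀ b ∈ H, assocForm Q y b = 1) → assocForm Q y a = 1) : a ∈ H := by
  have := (CommGroup.forall_monoidHom_apply_eq_one_iff (M := ℂ) (AddSubgroup.toSubgroup H)
    (Multiplicative.ofAdd a)).1 ?_
  · exact this
  · intro φ hφ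
    obtain ⟨y, hy⟩ := h.exists_eq_pairing (AddMonoidHom.toMultiplicativeLeft.symm φ)
    have hval : ∀ b : A, φ (Multiplicative.ofAdd b) = assocForm Q y b := fun b =>
      (congrArg Additive.toMul (DFunLike.congr_fun hy b)).symm
    rw [hval]
    refine ha y fun b hb => ?_
    rw [← hval]
    exact hφ _ hb

end Basic

theorem units_sq_eq_one_iff {u : ℂˣ} : u ^ 2 = 1 ↔ u = 1 ∨ u = -1 := by
  rw [← Units.val_inj, Units.val_pow_eq_pow_val, Units.val_one, sq_eq_one_iff, ← Units.val_inj,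
    ← Units.val_inj, Units.val_one, Units.val_neg, Units.val_one]

/-! ### Gauss data from quadratic square roots on a covering group. -/

section Lift

variable {A : Type*} [AddCommGroup A] {Q : A → ℂˣ}

/-- For an abelian symmetric cochain `σ`, the pair `(σ, ∂σ)` is an abelian 3-cocycle. -/
theorem IsAbelianSymmCochain.isAbelianThreeCocycle {σ : A → A → ℂˣ}
    (h : IsAbelianSymmCochain σ) : IsAbelianThreeCocycle σ (bdry σ) := by
  have hinv : ∀ a b c, (bdry σ a b c)⁻¹ = bdry σ a b c := fun a b c => by
    rcases h.bdry_sign a b c with h | h <;> simp [h]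
  have hcomm : ∀ a b c, bdry σ a b c = bdry σ a c b := fun a b c => by
    rw [bdry, bdry, add_comm c b, mul_comm (σ a b)]
  have hmul : ∀ a b c, bdry σ a b c * bdry σ a b c = 1 := fun a b c => by
    rcases h.bdry_sign a b c with h | h <;> simp [h]
  refine ⟨fun a b c d => ?_, fun a b c => ?_, fun a b c => ?_⟩
  -- Additivity in the first argument cancels ω(b,c,d); what remains is that the coboundary of
  -- σ(a,·) is a 2-cocycle.
  · rw [h.bdry_add, mul_comm (bdry σ a c d), mul_assoc, mul_assoc]
    congr 1
    simp only [bdry, add_assoc]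
    ext
    push_cast
    field_simp
  · rw [hcomm b a c, mul_comm, ← div_div, div_self', one_div, bdry]
    simp only [mul_inv, inv_inv, div_eq_mul_inv, mul_comm]
  · rw [hcomm a b c, mul_comm, mul_div_assoc, div_self', mul_one, ← hinv, bdry, h.symm c a,
      h.symm c b, h.symm c]
    simp only [mul_inv, inv_inv, div_eq_mul_inv, mul_comm]

/-- A quadratic function `r` on a group surjecting onto `A` with `r² = Q` gives data
`(σ, ω, q, δ)` for `Q`, if the associated form of `r` vanishes on the kernel and `δ`
represents `r` there. -/
theorem GaussDatum.nonempty_of_lift {M : Type*} [AddCommGroup M] (hQ : IsQuadratic Q)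
    (π : M →+ A) (hπ : Function.Surjective π) {r : M → ℂˣ} (hr : IsQuadratic r)
    (hsq : ∀ a, r a ^ 2 = Q (π a))
    (hker : ∀ a b, π a = 0 → π b = 0 → assocForm r a b = 1)
    (δ : M) (hδ : π (2 • δ) = 0) (hδr : ∀ N, π N = 0 → assocForm r δ N = r N) :
    Nonempty (GaussDatum Q) := by
  classical
  -- A section of π; l(0) = 0 is needed for σ to be normalised.
  obtain ⟨l, hl, hl0⟩ : ∃ l : A → M, (∀ a, π (l a) = a) ∧ l 0 = 0 := by
    refine ⟨fun a => if a = 0 then 0 else Function.surjInv hπ a, fun a => ?_, by simp⟩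
    by_cases h : a = 0
    · simp [h]
    · simp [h, Function.surjInv_eq hπ]
  have hN : ∀ b c, π (l b + l c - l (b + c)) = 0 := fun b c => by simp [hl]
  have hbdry : ∀ a b c, bdry (fun a b => assocForm r (l a) (l b)) a b c =
      assocForm r (l a) (l b + l c - l (b + c)) := fun a b c => by
    rw [sub_eq_add_neg, hr.assoc_add_right, hr.assoc_add_right, hr.assoc_neg_right, bdry]
  -- Pairing with the kernel depends only on the image in A. This is what makes ω additive in its
  -- first argument although l is not.
  have hlift : ∀ x N, π N = 0 → assocForm r (l (π x)) N = assocForm r x N := fun x N h => by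
    have : π (l (π x) - x) = 0 := by simp [hl]
    have h1 := hker _ _ this h
    rwa [hr.assoc_sub_left, mul_inv_eq_one] at h1
  have hrN : ∀ N, π N = 0 → r N ^ 2 = 1 := fun N h => by rw [hsq, h, hQ.map_zero]
  have hsign : ∀ x N, π N = 0 → assocForm r x N ^ 2 = 1 := fun x N h => by
    rw [assocForm, mul_pow, mul_pow, inv_pow, inv_pow, hsq, hsq, hrN N h]
    simp [h]
  have hco : IsAbelianSymmCochain (fun a b => assocForm r (l a) (l b)) := by
    refine ⟨fun a => ?_, fun a => ?_, fun a b => assocForm_comm _ _ _, fun a b c => ?_,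
      fun a a' b c => ?_⟩
    · rw [hl0, hr.assoc_zero_left]
    · rw [hl0, hr.assoc_zero_right]
    · rw [hbdry]
      have := hsign (l a) _ (hN b c)
      exact units_sq_eq_one_iff.1 this
    · rw [hbdry, hbdry, hbdry, ← hr.assoc_add_left]
      have := hlift (l a + l a') _ (hN b c)
      rwa [_root_.map_add, hl, hl] at this
  refine ⟨⟨fun a b => assocForm r (l a) (l b), _, fun a => r (l a), π δ,
    hco.isAbelianThreeCocycle, hco, rfl, fun a => ?_, by rw [← _root_.map_nsmul, hδ],
    fun a => by rw [hsq, hl], fun a b => ?_⟩⟩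
  · rw [hr.assoc_self, hsq, hl]
  · rw [hbdry, hbdry, hlift _ _ (hN a b), hδr _ (hN a b)]
    -- N measures the failure of l to be additive: comparing r(l a + l b) with r(l(a+b)) leaves
    -- B_r(l(a+b),N) = ω(a+b,a,b) and r(N), which by the choice of δ is ω(δ,a,b). Both are signs, so
    -- inverses do not matter.
    set N := l a + l b - l (a + b) with hNdef
    have h1 := map_add_eq r (l a) (l b)
    have h2 := map_add_eq r (l (a + b)) N
    have h3 : l (a + b) + N = l a + l b := by rw [hNdef]; abel
    rw [h3, h1] at h2
    have h4 := hrN _ (hN a b)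
    have h5 := hsign (l (a + b)) _ (hN a b)
    calc r (l (a + b)) * (r (l a))⁻¹ * (r (l b))⁻¹
        = (r (l (a + b)) * r N * assocForm r (l (a + b)) N) *
          (assocForm r (l (a + b)) N) * r N * (r (l a))⁻¹ * (r (l b))⁻¹ *
          ((r N ^ 2)⁻¹ * (assocForm r (l (a + b)) N ^ 2)⁻¹) := by
            ext; push_cast; field_simp
      _ = _ := by
            rw [← h2, h4, h5]
            ext; push_cast; field_simp

/-- The quadratic form on `ℤ × ℤ` with prescribed coefficients. -/
def latticeForm (x y s : ℂˣ) (v : ℤ × ℤ) : ℂˣ := x ^ (v.1 ^ 2) * y ^ (v.2 ^ 2) * s ^ (v.1 * v.2)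

theorem assocForm_latticeForm (x y s : ℂˣ) (v w : ℤ × ℤ) :
    assocForm (latticeForm x y s) v w =
      x ^ (2 * v.1 * w.1) * y ^ (2 * v.2 * w.2) * s ^ (v.1 * w.2 + v.2 * w.1) := by
  rw [assocForm, mul_inv_eq_iff_eq_mul, mul_inv_eq_iff_eq_mul]
  simp only [latticeForm, Prod.fst_add, Prod.snd_add]
  have e1 : (v.1 + w.1) ^ 2 = 2 * v.1 * w.1 + w.1 ^ 2 + v.1 ^ 2 := by ring
  have e2 : (v.2 + w.2) ^ 2 = 2 * v.2 * w.2 + w.2 ^ 2 + v.2 ^ 2 := by ring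
  have e3 : (v.1 + w.1) * (v.2 + w.2) = (v.1 * w.2 + v.2 * w.1) + w.1 * w.2 + v.1 * v.2 := by ring
  rw [e1, e2, e3]
  simp only [zpow_add]
  ext; push_cast; ring

theorem isQuadratic_latticeForm (x y s : ℂˣ) : IsQuadratic (latticeForm x y s) where
  map_zsmul n a := by
    simp only [latticeForm, Prod.smul_fst, Prod.smul_snd, smul_eq_mul, mul_zpow, ← zpow_mul]
    congr 2 <;> ring_nf
  assoc_add_left a b c := by
    simp only [assocForm_latticeForm, Prod.fst_add, Prod.snd_add, mul_add, add_mul, zpow_add]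
    ext; push_cast; ring

/-- The homomorphism `(m, n) ↦ m x + n y`. -/
def linearComb (x y : A) : ℤ × ℤ →+ A :=
  (zmultiplesHom A x).coprod (zmultiplesHom A y)

theorem linearComb_apply (x y : A) (v : ℤ × ℤ) : linearComb x y v = v.1 • x + v.2 • y := rfl

theorem latticeForm_sq (hQ : IsQuadratic Q) {x y : A} {a b s : ℂˣ} (ha : a ^ 2 = Q x)
    (hb : b ^ 2 = Q y) (hs : s ^ 2 = assocForm Q x y) (v : ℤ × ℤ) :
    latticeForm a b s v ^ 2 = Q (linearComb x y v) := by
  rw [linearComb_apply, hQ.map_linearComb, ← ha, ← hb, ← hs, latticeForm, mul_pow, mul_pow]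
  simp only [← zpow_natCast, ← zpow_mul, mul_comm]

end Lift

/-! ### Products over the components of a Jordan decomposition. -/

section Product

variable {Γ : Type*} [AddCommGroup Γ] {Q : Γ → ℂˣ}

namespace JordanDecomposition

theorem coeAddMonoidHom_bijective (d : JordanDecomposition Q) :
    Function.Bijective (fun x : (∀ i, d.component i) => ∑ i, (x i : Γ)) := by
  classical
  have h := d.isInternal
  rw [DirectSum.IsInternal] at h
  have h2 := h.comp (DirectSum.addEquivProd fun i => d.component i).symm.bijective
  convert! h2 using 1
  funext x
  rw [Function.comp_apply, DirectSum.coeAddMonoidHom_eq_dfinsuppSum,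
    DFinsupp.sum_eq_sum_fintype _ (fun _ => rfl)]
  rfl

/-- A decomposed group as the product of the components. -/
noncomputable def equiv (d : JordanDecomposition Q) : (∀ i, d.component i) ≃+ Γ :=
  AddEquiv.ofBijective (AddMonoidHom.mk' (fun x : (∀ i, d.component i) => ∑ i, (x i : Γ))
    fun x y => by simp [Finset.sum_add_distrib]) d.coeAddMonoidHom_bijective

theorem equiv_apply (d : JordanDecomposition Q) (x : ∀ i, d.component i) :
    d.equiv x = ∑ i, (x i : Γ) := rfl

theorem map_equiv (d : JordanDecomposition Q) (hQ : IsQuadratic Q) (x : ∀ i, d.component i) :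
    Q (d.equiv x) = ∏ i, Q (x i) := by
  classical
  rw [equiv_apply]
  suffices h : ∀ s : Finset (Fin d.n), Q (∑ i ∈ s, (x i : Γ)) = ∏ i ∈ s, Q (x i) from h _
  intro s
  induction s using Finset.induction_on with
  | empty => simp [hQ.map_zero]
  | insert i s hi ih =>
    rw [Finset.sum_insert hi, Finset.prod_insert hi, map_add_eq Q, ih]
    have : assocForm Q (x i : Γ) (∑ j ∈ s, (x j : Γ)) = 1 := by
      rw [← hQ.pairing_apply, map_sum, toMul_sum]
      refine Finset.prod_eq_one fun j hj => ?_
      exact d.orthogonal i j (fun h => hi (h ▸ hj)) _ (x i).2 _ (x j).2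
    rw [this, mul_one]

theorem map_eq_prod (d : JordanDecomposition Q) (hQ : IsQuadratic Q) (a : Γ) :
    Q a = ∏ i, Q (d.equiv.symm a i) := by
  rw [← d.map_equiv hQ, AddEquiv.apply_symm_apply]

theorem bdry_prod {ι : Type*} [Fintype ι] {C : ι → Type*} [∀ i, AddCommGroup (C i)]
    (σ : ∀ i, C i → C i → ℂˣ) (e : Γ ≃+ ∀ i, C i) (a b c : Γ) :
    bdry (fun a b => ∏ i, σ i (e a i) (e b i)) a b c =
      ∏ i, bdry (σ i) (e a i) (e b i) (e c i) := by
  simp only [bdry, Finset.prod_mul_distrib, Finset.prod_inv_distrib, map_add, Pi.add_apply]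

theorem nonempty_gaussDatum (d : JordanDecomposition Q) (hQ : IsQuadratic Q)
    (h : ∀ i, Nonempty (GaussDatum (fun a : d.component i => Q a))) :
    Nonempty (GaussDatum Q) := by
  let c := fun i => (h i).some
  let e := d.equiv.symm
  have hω : ∀ i, (c i).ω = bdry (c i).σ := fun i => (c i).omega_eq
  have hb := bdry_prod (fun i => (c i).σ) e
  have hco : IsAbelianSymmCochain (fun a b => ∏ i, (c i).σ (e a i) (e b i)) := by
    refine ⟨fun a => ?_, fun a => ?_, fun a b => ?_, fun x y z => ?_, fun x x' y z => ?_⟩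
    · simp [(c _).isCochain.normalised_left]
    · simp [(c _).isCochain.normalised_right]
    · exact Finset.prod_congr rfl fun i _ => (c i).isCochain.symm _ _
    · rw [hb, ← units_sq_eq_one_iff, ← Finset.prod_pow]
      exact Finset.prod_eq_one fun i _ => units_sq_eq_one_iff.2 ((c i).isCochain.bdry_sign _ _ _)
    · rw [hb, hb, hb, ← Finset.prod_mul_distrib]
      refine Finset.prod_congr rfl fun i _ => ?_
      rw [map_add, Pi.add_apply, (c i).isCochain.bdry_add]
  refine ⟨⟨fun a b => ∏ i, (c i).σ (e a i) (e b i), _, fun a => ∏ i, (c i).q (e a i),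
    d.equiv fun i => (c i).δ, hco.isAbelianThreeCocycle, hco, rfl, fun a => ?_, ?_, fun a => ?_,
    fun a b => ?_⟩⟩
  · rw [d.map_eq_prod hQ]
    exact Finset.prod_congr rfl fun i _ => (c i).sigma_diag _
  · rw [← _root_.map_nsmul, AddEquiv.map_eq_zero_iff]
    exact funext fun i => (c i).two_delta
  · rw [d.map_eq_prod hQ, ← Finset.prod_pow]
    exact Finset.prod_congr rfl fun i _ => (c i).q_sq _
  · have he : e (d.equiv fun i => (c i).δ) = fun i => (c i).δ := d.equiv.symm_apply_apply _
    rw [hb, hb, he, ← Finset.prod_inv_distrib, ← Finset.prod_inv_distrib,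
      ← Finset.prod_mul_distrib, ← Finset.prod_mul_distrib, ← Finset.prod_mul_distrib,
      ← Finset.prod_mul_distrib]
    refine Finset.prod_congr rfl fun i _ => ?_
    rw [← hω, map_add, Pi.add_apply]
    exact (c i).q_add _ _

end JordanDecomposition
end Product

/-! ### Roots of unity. -/

theorem e_add (x y : ℝ) : e (x + y) = e x * e y := by
  simp only [e, ← Complex.exp_add]; congr 1; push_cast; ring

theorem e_ne_zero (x : ℝ) : e x ≠ 0 := Complex.exp_ne_zero _

theorem e_nat_mul (n : ℕ) (x : ℝ) : e (n * x) = e x ^ n := by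
  simp only [e, ← Complex.exp_nat_mul]; congr 1; push_cast; ring

theorem e_int_mul (n : ℤ) (x : ℝ) : e (n * x) = e x ^ n := by
  simp only [e, ← Complex.exp_int_mul]; congr 1; push_cast; ring

theorem e_one : e 1 = 1 := by simp [e, Complex.exp_two_pi_mul_I]

theorem e_intCast (n : ℤ) : e n = 1 := by
  simpa [e_one] using e_int_mul n 1

theorem e_half : e (1 / 2) = -1 := by
  rw [e, ← Complex.exp_pi_mul_I]; congr 1; push_cast; ring

theorem conj_e (x : ℝ) : starRingEnd ℂ (e x) = e (-x) := by
  rw [e, e, ← Complex.exp_conj]; congr 1; simp [map_ofNat]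

theorem isPrimitiveRoot_e (n : ℕ) (hn : n ≠ 0) : IsPrimitiveRoot (e (1 / n)) n := by
  convert Complex.isPrimitiveRoot_exp n hn using 1
  rw [e]; congr 1; push_cast; ring

theorem e_intCast_div (u : ℤ) (n : ℕ) : e ((u : ℝ) / n) = e (1 / n) ^ u := by
  rw [← e_int_mul]; congr 1; ring

theorem isPrimitiveRoot_e_div (u : ℤ) (n : ℕ) (hn : n ≠ 0) (h : IsCoprime u n) :
    IsPrimitiveRoot (e ((u : ℝ) / n)) n := by
  rw [e_intCast_div]
  exact (isPrimitiveRoot_e n hn).zpow_of_gcd_eq_one u (Int.isCoprime_iff_gcd_eq_one.1 h)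

/-- `e x` as a unit. -/
noncomputable def eUnit (x : ℝ) : ℂˣ := Units.mk0 (e x) (e_ne_zero x)

theorem exists_sq_eq (u : ℂˣ) : ∃ a : ℂˣ, a ^ 2 = u := by
  obtain ⟨z, hz⟩ := IsAlgClosed.exists_pow_nat_eq (u : ℂ) (n := 2) two_pos
  have hz0 : z ≠ 0 := by rintro rfl; simp at hz; exact u.ne_zero hz.symm
  exact ⟨Units.mk0 z hz0, Units.ext (by simpa using hz)⟩

theorem zpow_eq_one_of_dvd {G : Type*} [Group G] {a : G} {n : ℕ} (h : a ^ n = 1) {m : ℤ}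
    (hm : (n : ℤ) ∣ m) : a ^ m = 1 := by
  obtain ⟨c, rfl⟩ := hm
  rw [zpow_mul, zpow_natCast, h, one_zpow]

/-! ### Gauss data on each Jordan component. -/

section

variable {A : Type*} [AddCommGroup A] {Q : A → ℂˣ}

/-- The lift is r(m) = a^(m²) on ℤ; the second coordinate of ℤ × ℤ is idle. `han` kills the
associated form of r on nℤ, and `hδa` says that δ represents r there. -/
theorem nonempty_gaussDatum_cyclic (hQ : IsQuadratic Q) (x : A) (n : ℕ)
    (hgen : ∀ a, ∃ m : ℤ, m • x = a) (hord : ∀ m : ℤ, m • x = 0 → (n : ℤ) ∣ m)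
    (a : ℂˣ) (ha : a ^ 2 = Q x) (han : a ^ (2 * n ^ 2) = 1) (δ : ℤ) (hδ : (2 * δ) • x = 0)
    (hδa : ∀ m : ℤ, a ^ (2 * δ * (n * m)) = a ^ ((n * m) ^ 2)) :
    Nonempty (GaussDatum Q) := by
  have hker : ∀ v, linearComb x 0 v = 0 → (n : ℤ) ∣ v.1 := fun v hv =>
    hord _ (by simpa [linearComb_apply] using hv)
  refine GaussDatum.nonempty_of_lift hQ (linearComb x 0) (fun b => ?_)
    (isQuadratic_latticeForm a 1 1) (latticeForm_sq hQ ha ?_ ?_) (fun v w hv hw => ?_)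
    (δ, 0) ?_ (fun v hv => ?_)
  · obtain ⟨m, hm⟩ := hgen b
    exact ⟨(m, 0), by simpa [linearComb_apply] using hm⟩
  · simp [hQ.map_zero]
  · simp [hQ.assoc_zero_right]
  · simp only [assocForm_latticeForm, one_zpow, mul_one]
    refine zpow_eq_one_of_dvd han ?_
    obtain ⟨c, hc⟩ := hker v hv
    obtain ⟨d, hd⟩ := hker w hw
    exact ⟨c * d, by rw [hc, hd]; push_cast; ring⟩
  · simpa [linearComb_apply, mul_smul] using hδ
  · obtain ⟨c, hc⟩ := hker v hv
    simp only [assocForm_latticeForm, latticeForm, one_zpow, mul_one, hc]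
    exact hδa c

/-- The square roots have order dividing 2n, and 2n divides n² for even n. So r is trivial on the
kernel and δ = 0 works. -/
theorem nonempty_gaussDatum_rank_two (hQ : IsQuadratic Q) (x y : A) (n : ℕ) (hn : Even n)
    (hgen : Function.Surjective (linearComb x y))
    (hker : ∀ v, linearComb x y v = 0 → (n : ℤ) ∣ v.1 ∧ (n : ℤ) ∣ v.2)
    (hx : Q x ^ n = 1) (hy : Q y ^ n = 1) (hxy : assocForm Q x y ^ n = 1) :
    Nonempty (GaussDatum Q) := by
  obtain ⟨a, ha⟩ := exists_sq_eq (Q x)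
  obtain ⟨b, hb⟩ := exists_sq_eq (Q y)
  obtain ⟨s, hs⟩ := exists_sq_eq (assocForm Q x y)
  rw [← ha, ← pow_mul] at hx
  rw [← hb, ← pow_mul] at hy
  rw [← hs, ← pow_mul] at hxy
  have hdvd : ∀ c d : ℤ, (n : ℤ) ∣ c → (n : ℤ) ∣ d → ((2 * n : ℕ) : ℤ) ∣ c * d := by
    rintro _ _ ⟨c, rfl⟩ ⟨d, rfl⟩
    obtain ⟨m, hm⟩ := hn
    exact ⟨m * c * d, by rw [hm]; push_cast; ring⟩
  refine GaussDatum.nonempty_of_lift hQ (linearComb x y) hgen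
    (isQuadratic_latticeForm a b s) (latticeForm_sq hQ ha hb hs) (fun v w hv hw => ?_)
    0 (by simp) (fun v hv => ?_)
  · obtain ⟨h1, h2⟩ := hker v hv
    obtain ⟨h3, h4⟩ := hker w hw
    rw [assocForm_latticeForm, zpow_eq_one_of_dvd hx, zpow_eq_one_of_dvd hy,
      zpow_eq_one_of_dvd hxy, one_mul, one_mul]
    · exact dvd_add (hdvd _ _ h1 h4) (hdvd _ _ h2 h3)
    · rw [mul_assoc]; exact (hdvd _ _ h2 h4).mul_left 2
    · rw [mul_assoc]; exact (hdvd _ _ h1 h3).mul_left 2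
  · obtain ⟨h1, h2⟩ := hker v hv
    rw [(isQuadratic_latticeForm a b s).assoc_zero_left, latticeForm, zpow_eq_one_of_dvd hx,
      zpow_eq_one_of_dvd hy, zpow_eq_one_of_dvd hxy, one_mul, one_mul]
    · exact hdvd _ _ h1 h2
    · rw [sq]; exact hdvd _ _ h2 h2
    · rw [sq]; exact hdvd _ _ h1 h1

theorem ZMod.zsmul_equiv_one {n : ℕ} (f : ZMod n ≃+ A) (m : ℤ) : m • f 1 = f m := by
  rw [← map_zsmul, zsmul_one]

theorem ZMod.linearComb_equiv {n : ℕ} (f : (ZMod n × ZMod n) ≃+ A) (v : ℤ × ℤ) :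
    linearComb (f (1, 0)) (f (0, 1)) v = f (v.1, v.2) := by
  rw [linearComb_apply, ← map_zsmul, ← map_zsmul, ← map_add]
  simp

theorem odd_of_χ₈_eq {t : ZMod 8} {ε : ℤˣ} (h : ZMod.χ₈ t = (ε : ℤ)) {u : ℤ}
    (hu : (u : ZMod 8) = t) : Odd u := by
  subst hu
  rw [ZMod.χ₈_int_eq_if_mod_eight] at h
  by_contra hodd
  rw [Int.not_odd_iff_even, Int.even_iff] at hodd
  rw [if_pos hodd] at h
  exact ε.ne_zero h.symm

theorem JordanSymbol.Describes.nonempty_gaussDatum (hQ : IsQuadratic Q) {S : JordanSymbol}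
    (h : S.Describes Q) : Nonempty (GaussDatum Q) := by
  rcases S with ⟨p, k, ε⟩ | ⟨k, t, ε⟩ | ⟨k, ε⟩
  · obtain ⟨hp, hp2, hk, f, u, hu, -, hQ1⟩ := h
    have hodd : Odd (p ^ k) := (hp.odd_of_ne_two hp2).pow
    have h1 : Q (f 1) ^ (p ^ k) = 1 := by
      ext
      rw [Units.val_pow_eq_pow_val, hQ1, ← e_nat_mul, Units.val_one, ← e_intCast u]
      congr 1
      have : (p : ℝ) ≠ 0 := by exact_mod_cast hp.ne_zero
      push_cast; field_simp
    obtain ⟨j, hj⟩ := hodd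
    have hord : ∀ m : ℤ, m • f 1 = 0 → ((p ^ k : ℕ) : ℤ) ∣ m := fun m hm => by
      rw [ZMod.zsmul_equiv_one, AddEquiv.map_eq_zero_iff] at hm
      exact (ZMod.intCast_zmod_eq_zero_iff_dvd _ _).1 hm
    have ha : (Q (f 1) ^ (j + 1)) ^ p ^ k = 1 := by rw [← pow_mul, mul_comm, pow_mul, h1, one_pow]
    -- With p^k = 2j+1, the power j+1 of Q(x) is a square root of Q(x) that still has odd order, so
    -- r is trivial on the kernel and δ = 0.
    refine nonempty_gaussDatum_cyclic hQ (f 1) (p ^ k) (fun a => ?_) hord (Q (f 1) ^ (j + 1)) ?_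
      ?_ 0 (by simp) fun m => ?_
    · exact ⟨(f.symm a).cast, by rw [ZMod.zsmul_equiv_one]; simp⟩
    · rw [← pow_mul, show (j + 1) * 2 = p ^ k + 1 by omega, pow_add, h1, one_mul, pow_one]
    · rw [show 2 * (p ^ k) ^ 2 = p ^ k * (2 * p ^ k) by ring, pow_mul, ha, one_pow]
    · rw [mul_zero, zero_mul, zpow_zero]
      exact (zpow_eq_one_of_dvd ha ⟨(p ^ k : ℕ) * m ^ 2, by ring⟩).symm
  · obtain ⟨hk, hχ, f, u, hut, hQ1⟩ := h
    have hu := odd_of_χ₈_eq hχ hut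
    have ha2 : eUnit (u / 2 ^ (k + 2)) ^ 2 = Q (f 1) := by
      ext
      rw [Units.val_pow_eq_pow_val, hQ1, eUnit, Units.val_mk0, ← e_nat_mul]
      congr 1; push_cast; rw [pow_succ _ (k + 1)]; field_simp
    have hpow : ∀ m : ℕ, eUnit (u / 2 ^ (k + 2)) ^ m = eUnit (m * (u / 2 ^ (k + 2))) := fun m => by
      ext; simp [eUnit, e_nat_mul]
    have hord : ∀ m : ℤ, m • f 1 = 0 → ((2 ^ k : ℕ) : ℤ) ∣ m := fun m hm => by
      rw [ZMod.zsmul_equiv_one, AddEquiv.map_eq_zero_iff] at hm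
      exact (ZMod.intCast_zmod_eq_zero_iff_dvd _ _).1 hm
    have hgen : ∀ a, ∃ m : ℤ, m • f 1 = a := fun a =>
      ⟨(f.symm a).cast, by rw [ZMod.zsmul_equiv_one]; simp⟩
    have h2 : eUnit (u / 2 ^ (k + 2)) ^ 2 ^ (k + 2) = 1 := by
      rw [hpow]; ext
      rw [eUnit, Units.val_mk0, Units.val_one, ← e_intCast u]
      congr 1; push_cast; field_simp
    have h3 : eUnit (u / 2 ^ (k + 2)) ^ (2 * (2 ^ k) ^ 2) = 1 := by
      obtain ⟨j, rfl⟩ := Nat.exists_eq_add_of_lt hk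
      rw [show 2 * (2 ^ (0 + j + 1)) ^ 2 = 2 ^ (0 + j + 1 + 2) * 2 ^ j by ring, pow_mul, h2, one_pow]
    by_cases hk1 : k = 1
    · subst hk1
      -- Here a has order 8 and r(2m) = a^(4m²) = (-1)^m is nontrivial on the kernel; δ = 1
      -- represents it, since B_r(1,2m) = a^(4m) and m(m-1) is even.
      refine nonempty_gaussDatum_cyclic hQ (f 1) (2 ^ 1) hgen hord _ ha2 h3 1 ?_ fun m => ?_
      · rw [ZMod.zsmul_equiv_one]
        simp only [mul_one, EmbeddingLike.map_eq_zero_iff]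
        exact (ZMod.intCast_zmod_eq_zero_iff_dvd _ _).2 (by norm_num)
      · rw [← mul_inv_eq_one, ← zpow_neg, ← zpow_add]
        refine zpow_eq_one_of_dvd h2 ?_
        obtain ⟨j, hj⟩ := Int.even_mul_pred_self m
        exact ⟨-j, by push_cast; linear_combination (-4 : ℤ) * hj⟩
    -- For k ≥ 2 one has k + 2 ≤ 2k, so r is trivial on the kernel and δ = 0 is allowed.
    · refine nonempty_gaussDatum_cyclic hQ (f 1) (2 ^ k) hgen hord _ ha2 h3 0 (by simp) fun m => ?_
      rw [mul_zero, zero_mul, zpow_zero]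
      refine (zpow_eq_one_of_dvd h2 ?_).symm
      obtain ⟨j, rfl⟩ := Nat.exists_eq_add_of_le (show 2 ≤ k by omega)
      exact ⟨2 ^ j * m ^ 2, by push_cast; ring⟩
  · obtain ⟨hk, f, hB, h1, h2⟩ := h
    have hroot : ∀ v : ℂˣ, (v : ℂ) = e (1 / 2 ^ k) → v ^ 2 ^ k = 1 := fun v hv => by
      ext
      rw [Units.val_pow_eq_pow_val, hv, ← e_nat_mul, Units.val_one, ← e_one]
      congr 1; push_cast; field_simp
    have hQs : Q (f (1, 0)) ^ 2 ^ k = 1 ∧ Q (f (0, 1)) ^ 2 ^ k = 1 := by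
      rcases Int.units_eq_one_or ε with rfl | rfl
      · rw [(h1 rfl).1, (h1 rfl).2]; simp
      · exact ⟨hroot _ (h2 rfl).1, hroot _ (h2 rfl).2⟩
    refine nonempty_gaussDatum_rank_two hQ (f (1, 0)) (f (0, 1)) (2 ^ k)
      ((Nat.even_pow).2 ⟨even_two, hk.ne'⟩) (fun a => ?_) (fun v hv => ?_) hQs.1 hQs.2 (hroot _ hB)
    · exact ⟨((f.symm a).1.cast, (f.symm a).2.cast), by rw [ZMod.linearComb_equiv]; simp⟩
    · rw [ZMod.linearComb_equiv, AddEquiv.map_eq_zero_iff, Prod.mk_eq_zero] at hv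
      exact ⟨(ZMod.intCast_zmod_eq_zero_iff_dvd _ _).1 hv.1,
        (ZMod.intCast_zmod_eq_zero_iff_dvd _ _).1 hv.2⟩

theorem JordanDecomposition.gaussDatum_exists (d : JordanDecomposition Q) (hQ : IsQuadratic Q) :
    Nonempty (GaussDatum Q) :=
  d.nonempty_gaussDatum hQ fun i => (d.describes i).nonempty_gaussDatum (hQ.restrict _)

end

/-! ### Recognising Jordan components inside a form. -/

section

variable {A : Type*} [AddCommGroup A] {Q : A → ℂˣ}

theorem JordanSymbol.Describes.congr {D D' : Type*} [AddCommGroup D] [AddCommGroup D']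
    {Q : D → ℂˣ} {Q' : D' → ℂˣ} (g : D ≃+ D') (hg : ∀ a, Q' (g a) = Q a) {S : JordanSymbol}
    (h : S.Describes Q) : S.Describes Q' := by
  have hB : ∀ a b, assocForm Q' (g a) (g b) = assocForm Q a b := fun a b => by
    simp only [assocForm, ← map_add, hg]
  rcases S with ⟨p, k, ε⟩ | ⟨k, t, ε⟩ | ⟨k, ε⟩
  · obtain ⟨hp, hp2, hk, f, u, hu, hj, hQ1⟩ := h
    exact ⟨hp, hp2, hk, f.trans g, u, hu, hj, by simpa [hg] using hQ1⟩
  · obtain ⟨hk, hχ, f, u, hut, hQ1⟩ := h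
    exact ⟨hk, hχ, f.trans g, u, hut, by simpa [hg] using hQ1⟩
  · obtain ⟨hk, f, h0, h1, h2⟩ := h
    refine ⟨hk, f.trans g, ?_, ?_, ?_⟩
    · simpa [hB] using h0
    · simpa [hg] using h1
    · simpa [hg] using h2

/-- The homomorphism `ℤ/n → A` with `1 ↦ a`. -/
def zmodHom (n : ℕ) (a : A) (h : n • a = 0) : ZMod n →+ A :=
  ZMod.lift n ⟨zmultiplesHom A a, by simpa using h⟩

theorem zmodHom_intCast (n : ℕ) (a : A) (h : n • a = 0) (m : ℤ) : zmodHom n a h m = m • a := by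
  simp [zmodHom]

theorem zmodHom_one (n : ℕ) (a : A) (h : n • a = 0) : zmodHom n a h 1 = a := by
  simpa using zmodHom_intCast n a h 1

theorem injective_of_nondeg_pullback (hQ : IsQuadratic Q) {Z : Type*} [AddCommGroup Z]
    (g : Z →+ A) (h : ∀ v, (∀ w, assocForm Q (g v) (g w) = 1) → v = 0) :
    Function.Injective g := by
  rw [injective_iff_map_eq_zero]
  exact fun v hv => h v fun w => by rw [hv, hQ.assoc_zero_left]

theorem nondegOn_range_of_nondeg_pullback {Z : Type*} [AddCommGroup Z]
    (g : Z →+ A) (h : ∀ v, (∀ w, assocForm Q (g v) (g w) = 1) → v = 0) :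
    NondegOn Q g.range := by
  rintro _ ⟨v, rfl⟩ hv
  rw [h v fun w => hv _ ⟨w, rfl⟩, map_zero]

/-- A nonzero subgroup on which `Q` is an indecomposable Jordan component. -/
def IsBlock (Q : A → ℂˣ) (H : AddSubgroup A) : Prop :=
  H ≠ ⊥ ∧ NondegOn Q H ∧ ∃ S : JordanSymbol, S.Describes (fun a : H => Q a)

theorem isBlock_range (hQ : IsQuadratic Q) {Z : Type*} [AddCommGroup Z] [Nontrivial Z]
    (g : Z →+ A) (h : ∀ v, (∀ w, assocForm Q (g v) (g w) = 1) → v = 0) (S : JordanSymbol)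
    (hS : S.Describes (fun v => Q (g v))) : IsBlock Q g.range := by
  have hinj := injective_of_nondeg_pullback hQ g h
  refine ⟨?_, nondegOn_range_of_nondeg_pullback g h, S,
    hS.congr (AddMonoidHom.ofInjective hinj) fun a => rfl⟩
  obtain ⟨v, hv⟩ := exists_ne (0 : Z)
  intro hbot
  have : g v ∈ g.range := ⟨v, rfl⟩
  rw [hbot, AddSubgroup.mem_bot] at this
  exact hv (hinj (by rw [this, map_zero]))

theorem exists_pow_eq_of_isPrimitiveRoot {z v : ℂˣ} {n : ℕ} (hn : n ≠ 0)
    (hz : IsPrimitiveRoot z n) (h : v ^ n = 1) : ∃ a : ℕ, z ^ a = v := by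
  have : NeZero n := ⟨hn⟩
  obtain ⟨a, -, ha⟩ := (IsPrimitiveRoot.coe_units_iff.2 hz).eq_pow_of_pow_eq_one
    (ξ := (v : ℂ)) (by rw [← Units.val_pow_eq_pow_val, h, Units.val_one])
  exact ⟨a, Units.ext (by simpa using ha)⟩

theorem exists_int_of_pow_eq_one {v : ℂˣ} {n : ℕ} (hn : n ≠ 0) (h : v ^ n = 1) :
    ∃ u : ℤ, (v : ℂ) = e (u / n) := by
  have hz : IsPrimitiveRoot (eUnit (1 / n)) n :=
    IsPrimitiveRoot.coe_units_iff.1 (isPrimitiveRoot_e n hn)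
  obtain ⟨a, rfl⟩ := exists_pow_eq_of_isPrimitiveRoot hn hz h
  exact ⟨a, by rw [e_intCast_div, zpow_natCast]; rfl⟩

/-- A full-order value B(a,a) makes the cyclic group of a nondegenerate of order p^k. As Q(a)² =
B(a,a), it remains to see that Q(a) has order 2^(k+1) if p = 2 and p^k if p is odd. -/
theorem exists_isBlock_cyclic (hQ : IsQuadratic Q) {p k : ℕ} (hp : p.Prime) (hk : 0 < k) {a : A}
    (ha : p ^ k • a = 0) (h : IsPrimitiveRoot (assocForm Q a a) (p ^ k)) :
    ∃ H : AddSubgroup A, IsBlock Q H := by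
  have hn : 1 < p ^ k := Nat.one_lt_pow hk.ne' hp.one_lt
  have : Fact (1 < p ^ k) := ⟨hn⟩
  have hp0 : (p : ℝ) ≠ 0 := by exact_mod_cast hp.ne_zero
  have hg : ∀ v, (∀ w, assocForm Q (zmodHom (p ^ k) a ha v) (zmodHom (p ^ k) a ha w) = 1) →
      v = 0 := by
    intro v hv
    obtain ⟨m, rfl⟩ := ZMod.intCast_surjective v
    have h1 := hv 1
    rw [zmodHom_intCast, zmodHom_one, hQ.assoc_zsmul_left, h.zpow_eq_one_iff_dvd] at h1
    exact (ZMod.intCast_zmod_eq_zero_iff_dvd _ _).2 h1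
  suffices hS : ∃ S : JordanSymbol, S.Describes (fun v => Q (zmodHom (p ^ k) a ha v)) by
    obtain ⟨S, hS⟩ := hS
    exact ⟨_, isBlock_range hQ _ hg S hS⟩
  rw [hQ.assoc_self] at h
  by_cases hp2 : p = 2
  · subst hp2
    have h2 : Q a ^ (2 ^ (k + 1)) = 1 := by rw [pow_succ', pow_mul, h.pow_eq_one]
    obtain ⟨u, hu⟩ := exists_int_of_pow_eq_one (by positivity) h2
    have hodd : u % 2 = 1 := by
      rw [← Int.not_even_iff, even_iff_two_dvd]
      rintro ⟨v, rfl⟩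
      have : (Q a ^ 2) ^ 2 ^ (k - 1) = 1 := by
        ext
        rw [← pow_mul, ← pow_succ', Units.val_pow_eq_pow_val, hu, ← e_nat_mul, Units.val_one,
          ← e_intCast v]
        congr 1
        rw [Nat.sub_add_cancel hk]
        push_cast [pow_succ]; field_simp
      have := h.dvd_of_pow_eq_one _ this
      have := Nat.pow_dvd_pow_iff_le_right (le_refl 2) |>.1 this
      omega
    have h8 : ∃ ε : ℤˣ, ZMod.χ₈ (u : ZMod 8) = (ε : ℤ) := by
      rw [ZMod.χ₈_int_eq_if_mod_eight, if_neg (by omega)]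
      split_ifs
      exacts [⟨1, rfl⟩, ⟨-1, rfl⟩]
    obtain ⟨ε, hε⟩ := h8
    refine ⟨.two k u ε, hk, hε, AddEquiv.refl _, u, rfl, ?_⟩
    simp only [AddEquiv.refl_apply, zmodHom_one, hu]
    push_cast; rfl
  · have hodd : Odd (p ^ k) := (hp.odd_of_ne_two hp2).pow
    have hpp : Q a ^ p ^ k = 1 := by
      -- Both p^(2k) and 2p^k kill Q(a), and for odd p their greatest common divisor is p^k.
      have h1 : Q a ^ (p ^ k) ^ 2 = 1 := by rw [← hQ.map_nsmul, ha, hQ.map_zero]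
      have h2 : Q a ^ (2 * p ^ k) = 1 := by rw [pow_mul, h.pow_eq_one]
      have h3 := pow_gcd_eq_one.2 ⟨h1, h2⟩
      rwa [sq, Nat.gcd_mul_right, Nat.Coprime.gcd_eq_one (Nat.coprime_two_right.2 hodd),
        one_mul] at h3
    obtain ⟨u, hu⟩ := exists_int_of_pow_eq_one (by omega) hpp
    have hcop : IsCoprime u (p : ℤ) := by
      rw [isCoprime_comm, (Nat.prime_iff_prime_int.1 hp).coprime_iff_not_dvd]
      rintro ⟨v, rfl⟩
      have : (Q a ^ 2) ^ p ^ (k - 1) = 1 := by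
        ext
        rw [← pow_mul, Units.val_pow_eq_pow_val, hu, ← e_nat_mul, Units.val_one,
          ← e_intCast (2 * v)]
        congr 1
        rw [show k = (k - 1) + 1 by omega]
        push_cast [pow_succ, Nat.add_sub_cancel]; field_simp
      have := h.dvd_of_pow_eq_one _ this
      have := Nat.pow_dvd_pow_iff_le_right hp.one_lt |>.1 this
      omega
    have hjac : ∃ ε : ℤˣ, jacobiSym (2 * u) p = (ε : ℤ) := by
      have h2 : IsCoprime (2 * u) (p : ℤ) := by
        refine IsCoprime.mul_left ?_ hcop
        rw [← Nat.cast_two, Nat.isCoprime_iff_coprime]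
        exact (Nat.coprime_primes Nat.prime_two hp).2 (Ne.symm hp2)
      rcases jacobiSym.eq_one_or_neg_one (Int.isCoprime_iff_gcd_eq_one.1 h2) with h | h
      exacts [⟨1, h⟩, ⟨-1, h⟩]
    obtain ⟨ε, hε⟩ := hjac
    refine ⟨.odd p k ε, hp, hp2, hk, AddEquiv.refl _, u, hcop, hε, ?_⟩
    simp only [AddEquiv.refl_apply, zmodHom_one, hu]
    push_cast; rfl

/-- Hensel's lemma for the polynomial `c + mY + bY²` with `c` even and `m` odd. -/
theorem exists_root_mod_two_pow (k : ℕ) {c m : ℤ} (b : ℤ) (hc : Even c) (hm : Odd m) :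
    ∃ y : ℤ, (2 : ℤ) ^ k ∣ c + m * y + b * y ^ 2 := by
  suffices h : ∀ k : ℕ, ∃ y : ℤ, (2 : ℤ) ^ (k + 1) ∣ c + m * y + b * y ^ 2 by
    obtain ⟨y, hy⟩ := h k
    exact ⟨y, (pow_dvd_pow 2 k.le_succ).trans hy⟩
  intro k
  induction k with
  | zero => exact ⟨0, by simpa using hc.two_dvd⟩
  | succ k ih =>
    obtain ⟨y, z, hz⟩ := ih
    obtain ⟨j, hj⟩ := hm
    -- If the value at y is 2^(k+1) z, the shift adds m 2^(k+1) z modulo 2^(k+2), and 1 + m = 2(1 +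
    -- j) is even.
    refine ⟨y + 2 ^ (k + 1) * z, z * (1 + j + b * y + b * 2 ^ k * z), ?_⟩
    subst hj
    rw [pow_succ 2 (k + 1), pow_succ 2 k] at *
    linear_combination hz

theorem exists_inv_mod_two_pow (k : ℕ) {m : ℤ} (hm : Odd m) : ∃ g : ℤ, (2 : ℤ) ^ k ∣ m * g - 1 := by
  have h : IsCoprime m ((2 : ℤ) ^ k) := by
    refine IsCoprime.pow_right ?_
    obtain ⟨j, rfl⟩ := hm
    exact ⟨1, -j, by ring⟩
  obtain ⟨a, b, hab⟩ := h
  exact ⟨a, -b, by linear_combination hab⟩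

theorem zpow_eq_zpow_of_dvd {G : Type*} [Group G] {z : G} {n : ℕ} (h : z ^ n = 1) {a b : ℤ}
    (hab : (n : ℤ) ∣ a - b) : z ^ a = z ^ b := by
  have := zpow_eq_one_of_dvd h hab
  rwa [zpow_sub, mul_inv_eq_one] at this

/-- Normal form of an even binary form over `ℤ/2^k` with odd off-diagonal entry. -/
theorem exists_normal_pair (hQ : IsQuadratic Q) (k : ℕ) {z : ℂˣ} (hz : z ^ 2 ^ k = 1)
    {x y : A} (hx : 2 ^ k • x = 0) (hy : 2 ^ k • y = 0) {a b g : ℤ} (hg : Odd g)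
    (hQx : Q x = z ^ a) (hQy : Q y = z ^ b) (hB : assocForm Q x y = z ^ g)
    (hab : Even a ∨ Odd b) :
    ∃ x' y' : A, 2 ^ k • x' = 0 ∧ 2 ^ k • y' = 0 ∧ assocForm Q x' y' = z ∧
      ((Q x' = 1 ∧ Q y' = 1) ∨ (Q x' = z ∧ Q y' = z)) := by
  have hzd : ∀ {m n : ℤ}, (2 : ℤ) ^ k ∣ m - n → z ^ m = z ^ n := fun h =>
    zpow_eq_zpow_of_dvd hz (by exact_mod_cast h)
  have hcomb : ∀ (u v : A) (m n : ℤ), 2 ^ k • u = 0 → 2 ^ k • v = 0 → 2 ^ k • (m • u + n • v) = 0 :=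
    fun u v m n hu hv => by
      rw [smul_add, smul_comm _ m, smul_comm _ n, hu, hv, smul_zero, smul_zero, add_zero]
  -- The residue c of a modulo 2 decides the type: c = 0 leads to the hyperbolic plane; c = 1 forces
  -- b odd and leads to the other plane.
  obtain ⟨c, hc, hac, hbc⟩ : ∃ c : ℤ, (c = 0 ∨ c = 1) ∧ Even (a - c) ∧ (c = 1 → Odd b) := by
    rcases Int.even_or_odd a with ha | ha
    · exact ⟨0, Or.inl rfl, by simpa using ha, by simp⟩
    · refine ⟨1, Or.inr rfl, ha.sub_odd odd_one, fun _ => hab.resolve_left ?_⟩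
      exact Int.not_even_iff_odd.2 ha
  -- Solves Q(x + ty) = z^c, that is, a + gt + bt² ≡ c.
  obtain ⟨t, ht⟩ := exists_root_mod_two_pow k b hac hg
  set x' := (1 : ℤ) • x + t • y with hx'
  have hQx' : Q x' = z ^ c := by
    rw [hx', hQ.map_linearComb, hQx, hQy, hB, ← zpow_mul, ← zpow_mul, ← zpow_mul, ← zpow_add,
      ← zpow_add]
    exact hzd (by convert ht using 1; ring)
  have hBx'y : assocForm Q x' y = z ^ (g + 2 * b * t) := by
    rw [hx', hQ.assoc_add_left, hQ.assoc_zsmul_left, hQ.assoc_zsmul_left, hQ.assoc_self, hB, hQy,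
      ← zpow_natCast, ← zpow_mul, ← zpow_mul, ← zpow_mul, ← zpow_add]
    congr 1; push_cast; ring
  have hg' : Odd (g + 2 * b * t) := by
    rw [mul_assoc]; exact hg.add_even (even_two_mul _)
  obtain ⟨s, hs⟩ := exists_inv_mod_two_pow k hg'
  have hBx's : assocForm Q x' (s • y) = z := by
    rw [hQ.assoc_zsmul_right, hBx'y, ← zpow_mul]
    simpa using hzd hs
  have hQs : Q (s • y) = z ^ (b * s ^ 2) := by rw [hQ.map_zsmul, hQy, ← zpow_mul]
  have hsy : 2 ^ k • (s • y) = 0 := by rw [smul_comm, hy, smul_zero]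
  have hx'0 := hcomb x y 1 t hx hy
  rw [← hx'] at hx'0
  have hval : ∀ m n : ℤ, Q (m • x' + n • s • y) = z ^ (c * m ^ 2 + b * s ^ 2 * n ^ 2 + m * n) ∧
      assocForm Q x' (m • x' + n • s • y) = z ^ (2 * c * m + n) := fun m n => by
    constructor
    · rw [hQ.map_linearComb, hQx', hQs, hBx's, ← zpow_mul, ← zpow_mul, ← zpow_add, ← zpow_add]
    · rw [hQ.assoc_add_right, hQ.assoc_zsmul_right, hQ.assoc_zsmul_right, hQ.assoc_self, hBx's,
        hQx', ← zpow_natCast, ← zpow_mul, ← zpow_mul, ← zpow_add]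
      congr 1; push_cast; ring
  rcases hc with rfl | rfl
  -- With x' isotropic and paired to z with sy, subtracting bs² x' from sy makes it isotropic too.
  · refine ⟨x', (-(b * s ^ 2)) • x' + (1 : ℤ) • s • y, hx'0, hcomb _ _ _ _ hx'0 hsy, ?_,
      Or.inl ⟨by simpa using hQx', ?_⟩⟩
    · rw [(hval _ _).2]; simp
    · rw [(hval _ _).1, ← zpow_zero z]; congr 1; ring
  · have hsodd : k = 0 ∨ Odd s := by
      rcases Nat.eq_zero_or_pos k with h | h
      · exact Or.inl h
      · right
        rw [← Int.not_even_iff_odd]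
        intro hse
        have h1 : Even ((g + 2 * b * t) * s - 1) :=
          even_iff_two_dvd.2 ((dvd_pow_self 2 h.ne').trans hs)
        have h2 := (hse.mul_left (g + 2 * b * t)).sub_odd odd_one
        exact Int.not_even_iff_odd.2 h2 h1
    rcases hsodd with rfl | hsodd
    · have hz1 : z = 1 := by simpa using hz
      exact ⟨x', s • y, hx'0, hsy, hBx's, Or.inl ⟨by simpa [hz1] using hQx', by simp [hQs, hz1]⟩⟩
    · have hbs : Odd (b * s ^ 2) := (hbc rfl).mul hsodd.pow
      -- The vectors w x' + (1-2w) sy all pair to z with x'; requiring Q = z is the quadratic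
      -- congruence in w solved here.
      obtain ⟨w, hw⟩ := exists_root_mod_two_pow k (c := b * s ^ 2 - 1) (m := 1 - 4 * (b * s ^ 2))
        (4 * (b * s ^ 2) - 1) (hbs.sub_odd odd_one)
        (odd_one.sub_even ((by decide : Even (4 : ℤ)).mul_right _))
      refine ⟨x', w • x' + (1 - 2 * w) • s • y, hx'0, hcomb _ _ _ _ hx'0 hsy, ?_,
        Or.inr ⟨by simpa using hQx', ?_⟩⟩
      · rw [(hval _ _).2]
        conv_rhs => rw [← zpow_one z]
        congr 1; ring
      · rw [(hval _ _).1]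
        conv_rhs => rw [← zpow_one z]
        exact hzd (by convert hw using 1; ring)

theorem exists_isBlock_binary (hQ : IsQuadratic Q) {k : ℕ} (hk : 0 < k) {x y : A}
    (hx : 2 ^ k • x = 0) (hy : 2 ^ k • y = 0) (hQx : Q x ^ 2 ^ k = 1) (hQy : Q y ^ 2 ^ k = 1)
    (hB : IsPrimitiveRoot (assocForm Q x y) (2 ^ k)) :
    ∃ H : AddSubgroup A, IsBlock Q H := by
  have hn : 1 < 2 ^ k := Nat.one_lt_two_pow hk.ne'
  have : Fact (1 < 2 ^ k) := ⟨hn⟩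
  have hz : (eUnit (1 / 2 ^ k) : ℂ) = e (1 / 2 ^ k) := rfl
  have hzp : IsPrimitiveRoot (eUnit (1 / 2 ^ k)) (2 ^ k) := by
    rw [← IsPrimitiveRoot.coe_units_iff, hz]
    simpa using isPrimitiveRoot_e (2 ^ k) (by positivity)
  obtain ⟨a, ha⟩ := exists_pow_eq_of_isPrimitiveRoot (by positivity) hzp hQx
  obtain ⟨b, hb⟩ := exists_pow_eq_of_isPrimitiveRoot (by positivity) hzp hQy
  obtain ⟨g, hg⟩ := exists_pow_eq_of_isPrimitiveRoot (by positivity) hzp hB.pow_eq_one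
  have hgodd : Odd g := by
    rw [← Nat.coprime_two_right]
    rw [← hg] at hB
    have := (hzp.pow_iff_coprime (by positivity) g).1 hB
    exact (Nat.coprime_pow_right_iff hk _ _).1 this
  generalize hzdef : eUnit (1 / 2 ^ k) = z at *
  obtain ⟨x', y', hx', hy', hB', hQ'⟩ : ∃ x' y' : A, 2 ^ k • x' = 0 ∧ 2 ^ k • y' = 0 ∧
      assocForm Q x' y' = z ∧ ((Q x' = 1 ∧ Q y' = 1) ∨ (Q x' = z ∧ Q y' = z)) := by
    have hg' : Odd (g : ℤ) := by exact_mod_cast hgodd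
    by_cases hab : Even a ∨ Odd b
    · refine exists_normal_pair hQ k hzp.pow_eq_one hx hy (a := a) (b := b) (g := g) hg' ?_ ?_ ?_ ?_
      · rw [zpow_natCast, ha]
      · rw [zpow_natCast, hb]
      · rw [zpow_natCast, hg]
      · exact_mod_cast hab
    -- For a odd and b even, exchanging x and y restores the parity hypothesis.
    · refine exists_normal_pair hQ k hzp.pow_eq_one hy hx (a := b) (b := a) (g := g) hg' ?_ ?_ ?_ ?_
      · rw [zpow_natCast, hb]
      · rw [zpow_natCast, ha]
      · rw [assocForm_comm, zpow_natCast, hg]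
      · rw [not_or, Nat.not_even_iff_odd, Nat.not_odd_iff_even] at hab
        exact_mod_cast Or.inl hab.2
  let G : (ZMod (2 ^ k) × ZMod (2 ^ k)) →+ A :=
    (zmodHom (2 ^ k) x' hx').coprod (zmodHom (2 ^ k) y' hy')
  have hG : ∀ m n : ℤ, G ((m : ZMod (2 ^ k)), (n : ZMod (2 ^ k))) = m • x' + n • y' := fun m n => by
    simp only [G, AddMonoidHom.coprod_apply, zmodHom_intCast]
  have hG1 : G (1, 0) = x' := by simpa using hG 1 0
  have hG2 : G (0, 1) = y' := by simpa using hG 0 1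
  have hnd : ∀ v, (∀ w, assocForm Q (G v) (G w) = 1) → v = 0 := by
    rintro ⟨v1, v2⟩ hv
    obtain ⟨m, rfl⟩ := ZMod.intCast_surjective v1
    obtain ⟨n, rfl⟩ := ZMod.intCast_surjective v2
    have h1 := hv (1, 0)
    have h2 := hv (0, 1)
    rw [hG, hG1, hQ.assoc_add_left, hQ.assoc_zsmul_left, hQ.assoc_zsmul_left, hQ.assoc_self,
      assocForm_comm Q y', hB'] at h1
    rw [hG, hG2, hQ.assoc_add_left, hQ.assoc_zsmul_left, hQ.assoc_zsmul_left, hQ.assoc_self,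
      hB'] at h2
    rw [Prod.mk_eq_zero, ZMod.intCast_zmod_eq_zero_iff_dvd, ZMod.intCast_zmod_eq_zero_iff_dvd]
    rcases hQ' with ⟨h3, h4⟩ | ⟨h3, h4⟩
    · rw [h3, one_pow, one_zpow, one_mul, hzp.zpow_eq_one_iff_dvd] at h1
      rw [h4, one_pow, one_zpow, mul_one, hzp.zpow_eq_one_iff_dvd] at h2
      exact ⟨h2, h1⟩
    · rw [h3, ← zpow_natCast, ← zpow_mul, ← zpow_add, hzp.zpow_eq_one_iff_dvd] at h1
      rw [h4, ← zpow_natCast, ← zpow_mul, ← zpow_add, hzp.zpow_eq_one_iff_dvd] at h2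
      -- The Gram matrix with rows (2,1) and (1,2) has determinant 3, a unit modulo 2^k.
      have h3 : IsCoprime ((2 ^ k : ℕ) : ℤ) 3 := by
        rw [Nat.cast_pow]; exact IsCoprime.pow_left ⟨-1, 1, by norm_num⟩
      constructor
      · refine h3.dvd_of_dvd_mul_left ?_
        convert (h1.mul_left 2).sub h2 using 1
        push_cast; ring
      · refine h3.dvd_of_dvd_mul_left ?_
        convert (h2.mul_left 2).sub h1 using 1
        push_cast; ring
  have hBz : ((assocForm (fun v => Q (G v)) (1, 0) (0, 1) : ℂˣ) : ℂ) = e (1 / 2 ^ k) := by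
    have : assocForm (fun v => Q (G v)) (1, 0) (0, 1) = assocForm Q (G (1, 0)) (G (0, 1)) := by
      simp only [assocForm, ← map_add]
    rw [this, hG1, hG2, hB', hz]
  rcases hQ' with ⟨h3, h4⟩ | ⟨h3, h4⟩
  · refine ⟨_, isBlock_range hQ G hnd (.twoII k 1) ⟨hk, AddEquiv.refl _, hBz, fun _ => ?_,
      fun h => absurd h (by decide)⟩⟩
    simp only [AddEquiv.refl_apply, hG1, hG2, h3, h4, and_self]
  · refine ⟨_, isBlock_range hQ G hnd (.twoII k (-1)) ⟨hk, AddEquiv.refl _, hBz,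
      fun h => absurd h (by decide), fun _ => ?_⟩⟩
    simp only [AddEquiv.refl_apply, hG1, hG2, h3, h4, hz, and_self]

end

/-! ### Existence of Jordan decompositions. -/

section

variable {A : Type*} [AddCommGroup A] {Q : A → ℂˣ}

theorem isPrimitiveRoot_prime_pow_of_pow_ne_one {p k : ℕ} (hp : p.Prime) (hk : 0 < k) {u : ℂˣ}
    (h1 : u ^ p ^ k = 1) (h2 : u ^ p ^ (k - 1) ≠ 1) : IsPrimitiveRoot u (p ^ k) := by
  have : Fact p.Prime := ⟨hp⟩
  obtain ⟨k, rfl⟩ := Nat.exists_eq_add_one.2 hk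
  rw [← orderOf_eq_prime_pow (n := k) h2 h1]
  exact IsPrimitiveRoot.orderOf u

/-- A nontrivial discriminant form contains a Jordan component. -/
theorem IsNondegQuadratic.exists_isBlock [Finite A] [Nontrivial A] (h : IsNondegQuadratic Q) :
    ∃ H : AddSubgroup A, IsBlock Q H := by
  have hQ := h.isQuadratic
  have hN1 : Nat.card A ≠ 1 := (Finite.one_lt_card (α := A)).ne'
  obtain ⟨p, hp, hpd⟩ := Nat.exists_prime_and_dvd hN1
  have hpfact : Fact p.Prime := ⟨hp⟩
  set N := AddMonoid.exponent A with hN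
  have hN0 : N ≠ 0 := AddMonoid.exponent_ne_zero_of_finite
  obtain ⟨x, hx⟩ := Nat.Prime.exists_addOrderOf_eq_pow_padic_val_nat_add_exponent A hp
  set k := N.factorization p with hkdef
  have hpN : p ∣ N := by
    obtain ⟨y, hy⟩ := exists_prime_addOrderOf_dvd_card' p hpd
    exact hy ▸ AddMonoid.addOrder_dvd_exponent y
  have hk : 0 < k := hp.factorization_pos_of_dvd hN0 hpN
  have hxk : p ^ k • x = 0 := by rw [← hx]; exact addOrderOf_nsmul_eq_zero x
  obtain ⟨m, hm⟩ : p ^ k ∣ N := Nat.ordProj_dvd N p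
  have hmp : p.Coprime m := by
    have := Nat.coprime_ordCompl hp hN0
    rwa [← hkdef, hm, Nat.mul_div_cancel_left _ (pow_pos hp.pos k)] at this
  obtain ⟨b, hb⟩ : ∃ b, assocForm Q x b ^ p ^ (k - 1) ≠ 1 := by
    by_contra! hall
    have h0 : p ^ (k - 1) • x = 0 := h.nondeg _ fun b => by rw [hQ.assoc_nsmul_left, hall]
    have := addOrderOf_dvd_of_nsmul_eq_zero h0
    rw [hx] at this
    have := (Nat.pow_dvd_pow_iff_le_right hp.one_lt).1 this
    omega
  have hpow : ∀ u v : A, p ^ k • u = 0 → assocForm Q u v ^ p ^ k = 1 := fun u v hu => by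
    rw [← hQ.assoc_nsmul_left, hu, hQ.assoc_zero_left]
  set y := m • b with hy
  have hyk : p ^ k • y = 0 := by
    rw [hy, ← mul_smul, ← hm]; exact AddMonoid.exponent_nsmul_eq_zero b
  have hxy : IsPrimitiveRoot (assocForm Q x y) (p ^ k) := by
    rw [hy, hQ.assoc_nsmul_right]
    exact (isPrimitiveRoot_prime_pow_of_pow_ne_one hp hk (hpow _ _ hxk) hb).pow_of_coprime _
      (hmp.symm.pow_right k)
  by_cases hcyc : ∃ a, p ^ k • a = 0 ∧ assocForm Q a a ^ p ^ (k - 1) ≠ 1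
  · obtain ⟨a, ha, ha'⟩ := hcyc
    exact exists_isBlock_cyclic hQ hp hk ha
      (isPrimitiveRoot_prime_pow_of_pow_ne_one hp hk (hpow _ _ ha) ha')
  push Not at hcyc
  -- Polarisation: if no B(a,a) has full order, then B(x+y,x+y) shows that B(x,y)² does not either,
  -- which is possible only for p = 2.
  have hp2 : p = 2 := by
    have h1 := hcyc (x + y) (by rw [smul_add, hxk, hyk, add_zero])
    rw [hQ.assoc_add_left, hQ.assoc_add_right, hQ.assoc_add_right, assocForm_comm Q y x, mul_pow,
      mul_pow, mul_pow, hcyc x hxk, hcyc y hyk, one_mul, mul_one, ← pow_add, ← two_mul] at h1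
    have h2 := hxy.dvd_of_pow_eq_one _ h1
    rw [show p ^ k = p * p ^ (k - 1) by rw [← pow_succ', Nat.sub_add_cancel hk]] at h2
    have h3 := Nat.dvd_of_mul_dvd_mul_right (pow_pos hp.pos _) h2
    exact (Nat.prime_dvd_prime_iff_eq hp Nat.prime_two).1 h3
  have hQpow : ∀ a, p ^ k • a = 0 → Q a ^ p ^ k = 1 := fun a ha => by
    have := hcyc a ha
    rw [hQ.assoc_self, ← pow_mul] at this
    have h2 : p ^ k = 2 * p ^ (k - 1) := by
      conv_rhs => rw [← hp2]
      rw [← pow_succ', Nat.sub_add_cancel hk]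
    rwa [h2]
  clear_value k
  subst hp2
  exact exists_isBlock_binary hQ hk hxk hyk (hQpow x hxk) (hQpow y hyk) hxy

/-- Induction on the order of K: a block H is nondegenerate, so K is the sum of H and its orthogonal
complement L in K, and L is again nondegenerate and strictly smaller. -/
theorem exists_orthogonal_blocks [Finite A] (hQ : IsQuadratic Q) (K : AddSubgroup A)
    (hK : NondegOn Q K) : ∃ (n : ℕ) (C : Fin n → AddSubgroup A), (∀ i, IsBlock Q (C i)) ∧
      (∀ i j, i ≠ j → ∀ a ∈ C i, ∀ b ∈ C j, assocForm Q a b = 1) ∧ ⨆ i, C i = K := by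
  induction hc : Nat.card K using Nat.strong_induction_on generalizing K with
  | _ c ih =>
    by_cases hbot : K = ⊥
    · exact ⟨0, Fin.elim0, fun i => i.elim0, fun i => i.elim0, by simp [hbot]⟩
    have : Nontrivial K := (AddSubgroup.nontrivial_iff_ne_bot K).2 hbot
    obtain ⟨H', hH'bot, hH'nd, S, hS⟩ := (hK.isNondegQuadratic hQ).exists_isBlock
    let H := H'.map K.subtype
    have hHK : H ≤ K := by
      rintro _ ⟨a, -, rfl⟩; exact a.2
    have hH : IsBlock Q H := by
      refine ⟨?_, ?_, S, hS.congr (H'.equivMapOfInjective _ K.subtype_injective) fun a => rfl⟩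
      · exact fun h => hH'bot ((AddSubgroup.map_eq_bot_iff_of_injective _ K.subtype_injective).1 h)
      · rintro _ ⟨a, ha, rfl⟩ h
        rw [hH'nd a ha fun b hb => h b ⟨b, hb, rfl⟩, map_zero]
    let L : AddSubgroup A :=
      { carrier := {a | a ∈ K ∧ ∀ b ∈ H, assocForm Q a b = 1}
        zero_mem' := ⟨K.zero_mem, fun b _ => hQ.assoc_zero_left b⟩
        add_mem' := fun ha hb => ⟨K.add_mem ha.1 hb.1, fun c hc => by
          rw [hQ.assoc_add_left, ha.2 c hc, hb.2 c hc, one_mul]⟩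
        neg_mem' := fun ha => ⟨K.neg_mem ha.1, fun c hc => by
          rw [hQ.assoc_neg_left, ha.2 c hc, inv_one]⟩ }
    have hLK : L ≤ K := fun a ha => ha.1
    have hsup : H ⊔ L = K := by
      refine le_antisymm (sup_le hHK hLK) fun a ha => ?_
      obtain ⟨x, hx, hx'⟩ := hH.2.1.exists_sub_orthogonal hQ a
      rw [← add_sub_cancel x a]
      exact AddSubgroup.add_mem_sup hx ⟨K.sub_mem ha (hHK hx), hx'⟩
    have hL : NondegOn Q L := by
      refine fun a ha h => hK a ha.1 fun b hb => ?_
      rw [← hsup] at hb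
      obtain ⟨x, hx, y, hy, rfl⟩ := AddSubgroup.mem_sup.1 hb
      rw [hQ.assoc_add_right, ha.2 x hx, h y hy, one_mul]
    have hlt : Nat.card L < c := by
      rw [← hc]
      refine lt_of_le_of_ne (AddSubgroup.card_le_of_le hLK) fun hcard => ?_
      have hLe : L = K := AddSubgroup.eq_of_le_of_card_ge hLK hcard.ge
      refine hH.1 ((AddSubgroup.eq_bot_iff_forall _).2 fun a ha => hH.2.1 a ha fun b hb => ?_)
      exact (hLe.ge (hHK ha)).2 b hb
    obtain ⟨n, C, hC, horth, hCL⟩ := ih _ hlt L hL rfl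
    have hle : ∀ i, C i ≤ L := fun i => hCL ▸ le_iSup C i
    refine ⟨n + 1, Fin.cons H C, fun i => ?_, fun i j hij => ?_, ?_⟩
    · cases i using Fin.cases with
      | zero => exact hH
      | succ i => exact hC i
    · cases i using Fin.cases with
      | zero =>
        cases j using Fin.cases with
        | zero => exact absurd rfl hij
        | succ j =>
          intro a ha b hb
          rw [assocForm_comm]
          exact (hle j hb).2 a ha
      | succ i =>
        cases j using Fin.cases with
        | zero => exact fun a ha b hb => (hle i ha).2 b hb
        | succ j => exact horth i j (fun h => hij (h ▸ rfl))
    · rw [← hsup, ← hCL]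
      refine le_antisymm (iSup_le fun i => ?_) (sup_le ?_ (iSup_le fun i => ?_))
      · cases i using Fin.cases with
        | zero => exact le_sup_left
        | succ i => exact (le_iSup C i).trans le_sup_right
      · exact le_iSup (Fin.cons H C : Fin (n + 1) → AddSubgroup A) 0
      · exact le_iSup (Fin.cons H C : Fin (n + 1) → AddSubgroup A) i.succ

/-- Pairing a vanishing sum with one component isolates the summand there, which nondegeneracy then
kills. -/
theorem isInternal_of_orthogonal (hQ : IsQuadratic Q) {n : ℕ} (C : Fin n → AddSubgroup A)
    (hnd : ∀ i, NondegOn Q (C i))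
    (horth : ∀ i j, i ≠ j → ∀ a ∈ C i, ∀ b ∈ C j, assocForm Q a b = 1) (hsup : ⨆ i, C i = ⊤) :
    DirectSum.IsInternal C := by
  classical
  have hsum : ∀ x, DirectSum.coeAddMonoidHom C x = ∑ i, (x i : A) := fun x => by
    rw [DirectSum.coeAddMonoidHom_eq_dfinsuppSum, DFinsupp.sum_eq_sum_fintype _ (fun _ => rfl)]
    rfl
  constructor
  · rw [injective_iff_map_eq_zero]
    intro x hx
    rw [hsum] at hx
    refine DFinsupp.ext fun i => Subtype.ext (hnd i _ (x i).2 fun b hb => ?_)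
    have h1 : assocForm Q b (∑ j, (x j : A)) = assocForm Q b (x i) := by
      rw [← hQ.pairing_apply, map_sum, toMul_sum]
      exact Finset.prod_eq_single i
        (fun j _ hj => horth i j hj.symm b hb _ (x j).2) (by simp)
    rw [assocForm_comm, ← h1, hx, hQ.assoc_zero_right]
  · have : (DirectSum.coeAddMonoidHom C).range = ⊤ := by
      rw [eq_top_iff, ← hsup]
      exact iSup_le fun i a ha => ⟨DirectSum.of (fun i => C i) i ⟨a, ha⟩, by simp⟩
    exact AddMonoidHom.range_eq_top.1 this

theorem IsNondegQuadratic.nonempty_jordanDecomposition [Finite A] (h : IsNondegQuadratic Q) :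
    Nonempty (JordanDecomposition Q) := by
  obtain ⟨n, C, hC, horth, hsup⟩ := exists_orthogonal_blocks h.isQuadratic ⊤ h.nondegOn_top
  choose S hS using fun i => (hC i).2.2
  exact ⟨⟨n, C, S, isInternal_of_orthogonal h.isQuadratic C (fun i => (hC i).2.1) horth hsup,
    horth, hS⟩⟩

end

/-! ### Absolute values and fourth powers of Gauss sums; the signature. -/

section

variable {A : Type*} [AddCommGroup A]

theorem sum_hom_eq_zero [Fintype A] (χ : A →+ Additive ℂˣ) (h : χ ≠ 0) :
    ∑ a, ((χ a).toMul : ℂ) = 0 := by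
  obtain ⟨c, hc⟩ : ∃ c, χ c ≠ 0 := by
    by_contra! hall
    exact h (AddMonoidHom.ext hall)
  have h1 : ∑ a, ((χ (a + c)).toMul : ℂ) = ∑ a, ((χ a).toMul : ℂ) :=
    Fintype.sum_equiv (Equiv.addRight c) _ _ fun _ => rfl
  simp only [map_add, toMul_add, Units.val_mul, ← Finset.sum_mul] at h1
  have h2 : ((χ c).toMul : ℂ) ≠ 1 := by
    rw [Ne, Units.val_eq_one]; exact hc
  by_contra hne
  exact h2 (mul_left_cancel₀ hne (by rw [h1, mul_one]))

open Classical in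
/-- The product of the Gauss sums of `F` and `F⁻¹` for a quadratic function `F` that is trivial on
the radical of its associated form. -/
theorem sum_mul_sum_inv [Fintype A] (F : A → ℂˣ)
    (hadd : ∀ a b c, assocForm F a (b + c) = assocForm F a b * assocForm F a c)
    (hrad : ∀ a, (∀ b, assocForm F a b = 1) → F a = 1) :
    (∑ a, (F a : ℂ)) * ∑ a, (F a : ℂ)⁻¹ =
      Nat.card A * Nat.card {a : A // ∀ b, assocForm F a b = 1} := by
  -- Substitute a = h + b; the sum over b is then a character sum, nonzero only for h in the
  -- radical.
  have h1 : (∑ a, (F a : ℂ)) * ∑ b, (F b : ℂ)⁻¹ = ∑ h, ∑ b, (F h : ℂ) * assocForm F h b := by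
    rw [Finset.mul_sum, Finset.sum_comm]
    refine Finset.sum_congr rfl fun b _ => ?_
    rw [Finset.sum_mul]
    refine (Fintype.sum_equiv (Equiv.addRight b) _ _ fun h => ?_).symm
    rw [Equiv.coe_addRight, map_add_eq F, Units.val_mul, Units.val_mul]
    field_simp
  have h2 : ∀ h, ∑ b, (F h : ℂ) * assocForm F h b =
      if ∀ b, assocForm F h b = 1 then (Nat.card A : ℂ) else 0 := fun h => by
    split_ifs with hh
    · simp [hh, hrad h hh]
    · rw [← Finset.mul_sum]
      have := sum_hom_eq_zero (AddMonoidHom.mk' (fun b => Additive.ofMul (assocForm F h b))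
        fun b c => by simp [hadd]) fun h0 => hh fun b =>
          congrArg Additive.toMul (DFunLike.congr_fun h0 b)
      simp only [AddMonoidHom.mk'_apply, toMul_ofMul] at this
      rw [this, mul_zero]
  rw [h1, Finset.sum_congr rfl fun h _ => h2 h, ← Finset.sum_filter, Finset.sum_const, nsmul_eq_mul,
    mul_comm, Nat.card_eq_fintype_card (α := {a : A // ∀ b, assocForm F a b = 1}),
    Fintype.card_subtype]

variable {Q : A → ℂˣ}

theorem IsNondegQuadratic.sum_mul_sum_inv [Fintype A] (h : IsNondegQuadratic Q) :
    (∑ a, (Q a : ℂ)) * ∑ a, (Q a : ℂ)⁻¹ = Nat.card A := by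
  have h1 : ∀ a, (∀ b, assocForm Q a b = 1) ↔ a = 0 := fun a =>
    ⟨h.nondeg a, by rintro rfl b; exact h.isQuadratic.assoc_zero_left b⟩
  rw [DiscForm.sum_mul_sum_inv Q h.assoc_add_right fun a ha => by
    rw [(h1 a).1 ha, h.isQuadratic.map_zero]]
  simp [h1]

theorem IsNondegQuadratic.sum_ne_zero [Fintype A] (h : IsNondegQuadratic Q) :
    ∑ a, (Q a : ℂ) ≠ 0 := by
  refine left_ne_zero_of_mul (b := ∑ a, (Q a : ℂ)⁻¹) ?_
  rw [h.sum_mul_sum_inv]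
  exact Nat.cast_ne_zero.2 Nat.card_pos.ne'

theorem IsNondegQuadratic.assocForm_sq_eq_one_iff (h : IsNondegQuadratic Q) (a : A) :
    (∀ b, assocForm Q a b ^ 2 = 1) ↔ 2 • a = 0 := by
  simp only [← h.isQuadratic.assoc_nsmul_left]
  exact ⟨h.nondeg _, fun h0 b => by rw [h0, h.isQuadratic.assoc_zero_left]⟩

/-- The Gauss sum of `Q(a)² B(δ, a)`, when this function is trivial on `Γ[2]`. -/
theorem IsNondegQuadratic.sum_sq_mul_sum_sq_inv [Fintype A] (h : IsNondegQuadratic Q) (δ : A)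
    (hδ : ∀ x, 2 • x = 0 → Q x ^ 2 * assocForm Q δ x = 1) :
    (∑ a, ((Q a ^ 2 * assocForm Q δ a : ℂˣ) : ℂ)) *
      ∑ a, ((Q a ^ 2 * assocForm Q δ a : ℂˣ) : ℂ)⁻¹ =
      Nat.card A * Nat.card (nsmulAddMonoidHom (α := A) 2).ker := by
  have hassoc : ∀ a b, assocForm (fun a => Q a ^ 2 * assocForm Q δ a) a b =
      assocForm Q a b ^ 2 := fun a b => by
    rw [assocForm, h.assoc_add_right, map_add_eq Q a b]
    ext; push_cast; field_simp
  rw [DiscForm.sum_mul_sum_inv (fun a => Q a ^ 2 * assocForm Q δ a)]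
  · simp only [hassoc, h.assocForm_sq_eq_one_iff]
    rfl
  · intro a b c
    rw [hassoc, hassoc, hassoc, h.assoc_add_right, mul_pow]
  · intro a ha
    simp only [hassoc, h.assocForm_sq_eq_one_iff] at ha
    exact hδ a ha

theorem map_linearComb_four (hQ : IsQuadratic Q) (k l m n : ℤ) (a b c d : A) :
    Additive.ofMul (Q (k • a + l • b + m • c + n • d)) =
      (k ^ 2) • Additive.ofMul (Q a) + (l ^ 2) • Additive.ofMul (Q b) +
      (m ^ 2) • Additive.ofMul (Q c) + (n ^ 2) • Additive.ofMul (Q d) +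
      (k * l) • Additive.ofMul (assocForm Q a b) + (k * m) • Additive.ofMul (assocForm Q a c) +
      (k * n) • Additive.ofMul (assocForm Q a d) + (l * m) • Additive.ofMul (assocForm Q b c) +
      (l * n) • Additive.ofMul (assocForm Q b d) + (m * n) • Additive.ofMul (assocForm Q c d) := by
  rw [map_add_eq Q, map_add_eq Q, map_add_eq Q]
  simp only [hQ.map_zsmul, hQ.assoc_add_left, hQ.assoc_zsmul_left, hQ.assoc_zsmul_right, ofMul_mul,
    ofMul_zpow]
  module

/-- `Q` on four summands is multiplied by the norm under quaternion multiplication. -/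
theorem map_quaternion (hQ : IsQuadratic Q) (k l m n : ℤ) (a b c d : A) :
    Q (k • a + l • b + m • c + n • d) * Q ((-l) • a + k • b + (-n) • c + m • d) *
      Q ((-m) • a + n • b + k • c + (-l) • d) * Q ((-n) • a + (-m) • b + l • c + k • d) =
    (Q a * Q b * Q c * Q d) ^ (k ^ 2 + l ^ 2 + m ^ 2 + n ^ 2) := by
  apply Additive.ofMul.injective
  simp only [ofMul_mul, ofMul_zpow, map_linearComb_four hQ]
  module

/-- N = |A|² kills both A and the values of Q. Writing N - 1 as a sum of four squares gives an
integral quaternion whose norm acts as -1; multiplying by it permutes A⁴ and inverts the fourfold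
product of Q. -/
theorem sum_pow_four_eq [Fintype A] (hQ : IsQuadratic Q) :
    (∑ a, (Q a : ℂ)) ^ 4 = (∑ a, (Q a : ℂ)⁻¹) ^ 4 := by
  set N := Nat.card A ^ 2 with hN
  have hNpos : 0 < N := pow_pos Nat.card_pos 2
  obtain ⟨k, l, m, n, hsum⟩ := Nat.sum_four_squares (N - 1)
  have hsum' : (k : ℤ) ^ 2 + (l : ℤ) ^ 2 + (m : ℤ) ^ 2 + (n : ℤ) ^ 2 = N - 1 := by
    zify [hNpos] at hsum; exact hsum
  generalize (k : ℤ) = k, (l : ℤ) = l, (m : ℤ) = m, (n : ℤ) = n at hsum'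
  have hNv : ∀ v : A, ((N : ℤ) - 1) • v = -v := fun v => by
    rw [sub_smul, natCast_zsmul, hN, sq, mul_smul, card_nsmul_eq_zero', one_smul, zero_sub]
  have hQN : ∀ a, Q a ^ ((N : ℤ) - 1) = (Q a)⁻¹ := fun a => by
    rw [zpow_sub, zpow_natCast, hQ.pow_card_sq, zpow_one, one_mul]
  let f : A × A × A × A → A × A × A × A := fun v =>
    (k • v.1 + l • v.2.1 + m • v.2.2.1 + n • v.2.2.2,
      (-l) • v.1 + k • v.2.1 + (-n) • v.2.2.1 + m • v.2.2.2,
      (-m) • v.1 + n • v.2.1 + k • v.2.2.1 + (-l) • v.2.2.2,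
      (-n) • v.1 + (-m) • v.2.1 + l • v.2.2.1 + k • v.2.2.2)
  -- The negative of multiplication by the conjugate quaternion: conjugate times quaternion is the
  -- norm, which acts as -1.
  let g : A × A × A × A → A × A × A × A := fun v =>
    (-(k • v.1 + (-l) • v.2.1 + (-m) • v.2.2.1 + (-n) • v.2.2.2),
      -(l • v.1 + k • v.2.1 + n • v.2.2.1 + (-m) • v.2.2.2),
      -(m • v.1 + (-n) • v.2.1 + k • v.2.2.1 + l • v.2.2.2),
      -(n • v.1 + m • v.2.1 + (-l) • v.2.2.1 + k • v.2.2.2))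
  have hgf : Function.LeftInverse g f := by
    rintro ⟨a, b, c, d⟩
    have key : ∀ v : A, v = -((k ^ 2 + l ^ 2 + m ^ 2 + n ^ 2) • v) := fun v => by
      rw [hsum', hNv, neg_neg]
    simp only [f, g, Prod.mk.injEq]
    refine ⟨?_, ?_, ?_, ?_⟩
    · conv_rhs => rw [key a]
      module
    · conv_rhs => rw [key b]
      module
    · conv_rhs => rw [key c]
      module
    · conv_rhs => rw [key d]
      module
  have hbij : Function.Bijective f := Finite.injective_iff_bijective.1 hgf.injective
  have hpow : ∀ F : A → ℂ, (∑ a, F a) ^ 4 =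
      ∑ v : A × A × A × A, F v.1 * F v.2.1 * F v.2.2.1 * F v.2.2.2 := fun F => by
    simp only [Fintype.sum_prod_type, ← Finset.mul_sum, ← Finset.sum_mul]
    ring
  rw [hpow, hpow]
  refine (Fintype.sum_bijective f hbij _ _ fun v => ?_).symm
  have := map_quaternion hQ k l m n v.1 v.2.1 v.2.2.1 v.2.2.2
  rw [hsum', mul_zpow, mul_zpow, mul_zpow, hQN, hQN, hQN, hQN] at this
  have h2 := congrArg Units.val this
  push_cast at h2
  exact h2.symm

/-- With G' the sum of Q⁻¹, G G' = |A| and G⁴ = G'⁴ give G⁸ = |A|⁴, so the normalised sum is an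
eighth root of unity. -/
theorem IsNondegQuadratic.exists_isSignature [Fintype A] (h : IsNondegQuadratic Q) :
    ∃ r : ZMod 8, IsSignature Q r := by
  have h1 := h.sum_mul_sum_inv
  have h2 := sum_pow_four_eq h.isQuadratic
  set G := ∑ a, (Q a : ℂ)
  have hcard : (0 : ℝ) < Nat.card A := by exact_mod_cast Nat.card_pos
  have hsqrt : ((√(Nat.card A : ℝ) : ℝ) : ℂ) ^ 2 = Nat.card A := by
    rw [← Complex.ofReal_pow, Real.sq_sqrt hcard.le, Complex.ofReal_natCast]
  have hpow : (((√(Nat.card A : ℝ) : ℝ) : ℂ)⁻¹ * G) ^ 8 = 1 := by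
    have h3 : G ^ 8 = (Nat.card A : ℂ) ^ 4 := by
      rw [← h1, mul_pow, ← h2]; ring
    have h4 : ((√(Nat.card A : ℝ) : ℝ) : ℂ) ^ 8 = (Nat.card A : ℂ) ^ 4 := by rw [← hsqrt]; ring
    rw [mul_pow, inv_pow, h3, h4]
    exact inv_mul_cancel₀ (pow_ne_zero _ (by exact_mod_cast hcard.ne'))
  obtain ⟨i, hi, hi'⟩ := (isPrimitiveRoot_e 8 (by norm_num)).eq_pow_of_pow_eq_one hpow
  refine ⟨(i : ZMod 8), ?_⟩
  rw [IsSignature, ← hi', ZMod.val_natCast, Nat.mod_eq_of_lt hi, ← e_nat_mul]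
  congr 1; push_cast; ring

end

/-! ### Dependence of the partial Gauss sum on the data. -/

section Datum

variable {Γ : Type*} [AddCommGroup Γ] {Q : Γ → ℂˣ}

namespace GaussDatum

theorem omega_sq (c : GaussDatum Q) (a b d : Γ) : c.ω a b d ^ 2 = 1 := by
  rw [c.omega_eq]
  exact units_sq_eq_one_iff.2 (c.isCochain.bdry_sign a b d)

theorem omega_add (c : GaussDatum Q) (a a' b d : Γ) :
    c.ω (a + a') b d = c.ω a b d * c.ω a' b d := by
  rw [c.omega_eq, c.isCochain.bdry_add]

theorem omega_two (c : GaussDatum Q) (a b d : Γ) : c.ω (a + a) b d = 1 := by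
  rw [c.omega_add, ← sq, c.omega_sq]

theorem map_add_eq (c : GaussDatum Q) (a b : Γ) :
    c.q (a + b) = c.q a * c.q b * (c.σ a b * c.ω (a + b) a b * c.ω c.δ a b) := by
  rw [← c.q_add]
  ext; push_cast; field_simp

theorem sigma_sq (c : GaussDatum Q) (a b : Γ) : c.σ a b ^ 2 = assocForm Q a b := by
  have h := congrArg (· ^ 2) (c.q_add a b)
  simp only [mul_pow, inv_pow, c.omega_sq, c.q_sq, mul_one] at h
  rw [← h, assocForm]

theorem q_two (c : GaussDatum Q) (a : Γ) : c.q (2 • a) = Q a ^ 2 * c.ω c.δ a a := by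
  rw [two_nsmul, c.map_add_eq, c.omega_two, ← sq, c.q_sq, c.sigma_diag]
  ext; push_cast; ring

/-- ω(δ+2a,·,·) = ω(δ,·,·) because ω is a sign, so the two ω factors of `q_add` cancel. The sign
left in q(2a) combines with σ(δ,2a) to σ(δ,a)² = B(δ,a). -/
theorem q_delta_add (c : GaussDatum Q) (a : Γ) :
    c.q (c.δ + 2 • a) = c.q c.δ * (Q a ^ 2 * assocForm Q c.δ a) := by
  have h1 : c.ω c.δ a a * c.σ c.δ (2 • a) = assocForm Q c.δ a := by
    rw [← c.sigma_sq, c.omega_eq, bdry, two_nsmul, sq, inv_mul_cancel_right]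
  have h2 : c.ω (c.δ + 2 • a) c.δ (2 • a) * c.ω c.δ c.δ (2 • a) = 1 := by
    rw [two_nsmul, c.omega_add, c.omega_two, mul_one, ← sq, c.omega_sq]
  rw [c.map_add_eq, c.q_two, mul_assoc (c.σ _ _), h2, ← h1]
  ext; push_cast; ring

theorem sq_mul_assocForm_delta (c : GaussDatum Q) (x : Γ) (hx : 2 • x = 0) :
    Q x ^ 2 * assocForm Q c.δ x = 1 := by
  have := c.q_delta_add x
  rwa [hx, add_zero, left_eq_mul] at this

end GaussDatum

open Classical in
/-- Sums over a coset of `2Γ` in terms of sums over `Γ`. -/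
theorem card_ker_mul_sum_coset [Fintype Γ] (f : Γ → ℂ) (δ : Γ) :
    (Nat.card (nsmulAddMonoidHom (α := Γ) 2).ker : ℂ) *
      ∑ a with (QuotientAddGroup.mk a : Γ ⧸ twoMul Γ) = QuotientAddGroup.mk δ, f a =
      ∑ b, f (δ + 2 • b) := by
  rw [← Finset.sum_fiberwise_of_maps_to (s := Finset.univ) (g := fun b : Γ => δ + 2 • b)
    (t := Finset.univ.filter fun a => (QuotientAddGroup.mk a : Γ ⧸ twoMul Γ) =
      QuotientAddGroup.mk δ), Finset.mul_sum]
  · refine Finset.sum_congr rfl fun a ha => ?_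
    rw [Finset.mem_filter] at ha
    obtain ⟨b, hb⟩ := QuotientAddGroup.eq.1 ha.2.symm
    have hb' : δ + 2 • b = a := by
      rw [nsmulAddMonoidHom_apply] at hb
      rw [hb]; abel
    have hcard : Nat.card (nsmulAddMonoidHom (α := Γ) 2).ker =
        (Finset.univ.filter fun c : Γ => δ + 2 • c = a).card := by
      rw [← Fintype.card_subtype, ← Nat.card_eq_fintype_card]
      refine Nat.card_congr ((Equiv.addRight b).subtypeEquiv fun c => ?_)
      rw [AddMonoidHom.mem_ker, nsmulAddMonoidHom_apply, Equiv.coe_addRight, ← hb', smul_add]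
      simp
    rw [hcard, Finset.sum_congr rfl fun c hc => by rw [(Finset.mem_filter.1 hc).2],
      Finset.sum_const, nsmul_eq_mul]
  · intro b _
    rw [Finset.mem_filter]
    have hb : -δ + (δ + 2 • b) ∈ twoMul Γ := ⟨b, by simp⟩
    exact ⟨Finset.mem_univ _, (QuotientAddGroup.eq.2 hb).symm⟩

theorem card_ker_mul_card_twoMul [Finite Γ] :
    Nat.card (nsmulAddMonoidHom (α := Γ) 2).ker * Nat.card (twoMul Γ) = Nat.card Γ := by
  rw [twoMul, ← AddSubgroup.index_ker, AddSubgroup.card_mul_index]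

/-- Up to nonzero factors this is the Gauss sum of the inverse of Q² B(δ,·), which is trivial on the
radical Γ[2] of its associated form. -/
theorem gaussSum_ne_zero [Fintype Γ] (hQ : IsNondegQuadratic Q) (c : GaussDatum Q) :
    c.gaussSum ≠ 0 := by
  classical
  have hcard : ∀ H : AddSubgroup Γ, ((Nat.card H : ℕ) : ℂ) ≠ 0 := fun H =>
    Nat.cast_ne_zero.2 Nat.card_pos.ne'
  have h1 := hQ.sum_sq_mul_sum_sq_inv c.δ c.sq_mul_assocForm_delta
  have h2 : ∑ a, ((Q a ^ 2 * assocForm Q c.δ a : ℂˣ) : ℂ)⁻¹ ≠ 0 := by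
    refine right_ne_zero_of_mul (a := ∑ a, ((Q a ^ 2 * assocForm Q c.δ a : ℂˣ) : ℂ)) ?_
    rw [h1]
    exact mul_ne_zero (Nat.cast_ne_zero.2 Nat.card_pos.ne') (hcard _)
  have h3 := card_ker_mul_sum_coset (fun a => ((c.q a : ℂˣ) : ℂ)⁻¹) c.δ
  simp only [c.q_delta_add] at h3
  simp only [Units.val_mul (c.q c.δ), mul_inv, ← Finset.mul_sum] at h3
  rw [GaussDatum.gaussSum, partialGaussSum]
  refine mul_ne_zero (inv_ne_zero ?_) ?_
  · rw [Complex.ofReal_ne_zero, Real.sqrt_ne_zero']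
    exact_mod_cast Nat.card_pos
  · refine right_ne_zero_of_mul (a := (Nat.card (nsmulAddMonoidHom (α := Γ) 2).ker : ℂ)) ?_
    rw [h3]
    exact mul_ne_zero (inv_ne_zero (Units.ne_zero _)) (by simpa only [Units.val_mul, mul_inv] using h2)

/-- Multiplying `q` by a character `B(x, ·)` of order two. -/
def GaussDatum.twist (c : GaussDatum Q) (hQ : IsQuadratic Q) (x : Γ) (hx : 2 • x = 0) :
    GaussDatum Q :=
  { c with
    q := fun a => c.q a * assocForm Q x a
    q_sq := fun a => by
      rw [mul_pow, c.q_sq, ← hQ.assoc_nsmul_left, hx, hQ.assoc_zero_left, mul_one]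
    q_add := fun a b => by
      rw [← c.q_add, hQ.assoc_add_right]
      ext; push_cast; field_simp }

/-- B(x,·) is trivial on 2Γ, hence constant on the coset of δ. -/
theorem GaussDatum.gaussSum_twist [Fintype Γ] (c : GaussDatum Q) (hQ : IsQuadratic Q) (x : Γ)
    (hx : 2 • x = 0) :
    (c.twist hQ x hx).gaussSum = (assocForm Q x c.δ : ℂ)⁻¹ * c.gaussSum := by
  classical
  rw [gaussSum, gaussSum, partialGaussSum, partialGaussSum, mul_left_comm, Finset.mul_sum _ _
    (assocForm Q x c.δ : ℂ)⁻¹]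
  congr 1
  refine Finset.sum_congr rfl fun a ha => ?_
  rw [Finset.mem_filter] at ha
  obtain ⟨b, hb⟩ := QuotientAddGroup.eq.1 ha.2.symm
  have ha' : a = c.δ + 2 • b := by
    rw [nsmulAddMonoidHom_apply] at hb
    rw [hb]; simp
  have hxa : assocForm Q x a = assocForm Q x c.δ := by
    rw [ha', hQ.assoc_add_right, hQ.assoc_nsmul_right, ← hQ.assoc_nsmul_left, hx,
      hQ.assoc_zero_left, mul_one]
  simp only [twist, hxa, Units.val_mul, mul_inv, mul_comm]

/-- If `Q²` is nontrivial on `Γ[2]`, the partial Gauss sum depends on the data. -/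
theorem exists_gaussSum_ne [Fintype Γ] (hQ : IsNondegQuadratic Q) (c : GaussDatum Q) (x : Γ)
    (hx : 2 • x = 0) (hQx : Q x ^ 2 ≠ 1) : ∃ c' : GaussDatum Q, c'.gaussSum ≠ c.gaussSum := by
  refine ⟨c.twist hQ.isQuadratic x hx, fun h => hQx ?_⟩
  rw [c.gaussSum_twist, mul_eq_right₀ (gaussSum_ne_zero hQ c), inv_eq_one,
    Units.val_eq_one, assocForm_comm] at h
  simpa [h] using c.sq_mul_assocForm_delta x hx

/-- The orthogonal complement of 2Γ is Γ[2], on which B(δ,·) = Q⁻² = 1; so δ lies in the double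
complement of 2Γ. -/
theorem GaussDatum.delta_mem_twoMul [Finite Γ] (hQ : IsNondegQuadratic Q) (c : GaussDatum Q)
    (h2 : ∀ x, 2 • x = 0 → Q x ^ 2 = 1) : c.δ ∈ twoMul Γ := by
  refine hQ.mem_of_orthogonal _ _ fun y hy => ?_
  have hy2 : 2 • y = 0 := by
    rw [← hQ.assocForm_sq_eq_one_iff]
    intro b
    rw [← hQ.isQuadratic.assoc_nsmul_right]
    exact hy _ ⟨b, rfl⟩
  have := c.sq_mul_assocForm_delta y hy2
  rwa [h2 y hy2, one_mul, assocForm_comm] at this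

theorem GaussDatum.partialGaussSum_zero [Fintype Γ] (hQ : IsNondegQuadratic Q) (c : GaussDatum Q)
    (h2 : ∀ x, 2 • x = 0 → Q x ^ 2 = 1) :
    partialGaussSum c.q 0 = ((√(Nat.card (twoMul Γ) : ℝ) : ℝ) : ℂ)⁻¹ *
      ((Nat.card (nsmulAddMonoidHom (α := Γ) 2).ker : ℂ)⁻¹ * ∑ a, ((Q a : ℂ) ^ 2)⁻¹) := by
  classical
  rw [partialGaussSum]
  congr 1
  rw [eq_inv_mul_iff_mul_eq₀ (Nat.cast_ne_zero.2 Nat.card_pos.ne')]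
  have h3 := card_ker_mul_sum_coset (fun a => ((c.q a : ℂˣ) : ℂ)⁻¹) 0
  obtain ⟨ε, hε⟩ := c.delta_mem_twoMul hQ h2
  have hω : ∀ a, c.ω c.δ a a = 1 := fun a => by
    rw [← hε, nsmulAddMonoidHom_apply, two_nsmul, c.omega_two]
  simp only [zero_add, c.q_two, hω, mul_one, Units.val_pow_eq_pow_val] at h3
  rw [← h3]
  congr!

end Datum

/-! ### Explicit quadratic Gauss sums and the effect of squaring the root of unity. -/

section Sums

theorem sum_range_mul_eq {M : Type*} [AddCommMonoid M] (f : ℕ → M) (m n : ℕ) :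
    ∑ a ∈ Finset.range (m * n), f a =
      ∑ c ∈ Finset.range m, ∑ b ∈ Finset.range n, f (b + n * c) := by
  induction m with
  | zero => simp
  | succ m ih =>
    rw [Nat.succ_mul, Finset.sum_range_add, ih, Finset.sum_range_succ]
    congr 1
    exact Finset.sum_congr rfl fun b _ => by rw [add_comm, mul_comm]

theorem sum_zmod_eq_sum_range {M : Type*} [AddCommMonoid M] (n : ℕ) [NeZero n] (f : ℕ → M) :
    ∑ x : ZMod n, f x.val = ∑ a ∈ Finset.range n, f a := by
  cases n with
  | zero => exact absurd rfl (NeZero.ne 0)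
  | succ n => exact Fin.sum_univ_eq_sum_range f (n + 1)

/-- The quadratic Gauss sum modulo `p^(j+2)` in terms of the one modulo `p^j`. -/
theorem sum_pow_sq_prime_pow (p j : ℕ) (hp : p.Prime) (z : ℂ)
    (hz : IsPrimitiveRoot (z ^ (2 * p ^ (j + 1))) p) (hz1 : z ^ (p ^ (j + 1)) ^ 2 = 1) :
    ∑ a ∈ Finset.range (p ^ (j + 2)), z ^ a ^ 2 =
      p * ∑ b ∈ Finset.range (p ^ j), (z ^ p ^ 2) ^ b ^ 2 := by
  set w := z ^ (2 * p ^ (j + 1)) with hw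
  -- Writing an index as b + p^(j+1) c, the sum over c is geometric with ratio w^b, so only b
  -- divisible by p survives.
  have hgeom : ∀ b : ℕ, ∑ c ∈ Finset.range p, (w ^ b) ^ c = if p ∣ b then (p : ℂ) else 0 := by
    intro b
    split_ifs with h
    · rw [(hz.pow_eq_one_iff_dvd b).2 h]; simp
    · have h1 : w ^ b ≠ 1 := fun h1 => h ((hz.pow_eq_one_iff_dvd b).1 h1)
      have h2 := mul_geom_sum (w ^ b) p
      rw [← pow_mul w, mul_comm b p, pow_mul w, hz.pow_eq_one, one_pow, sub_self] at h2
      exact (mul_eq_zero.1 h2).resolve_left (sub_ne_zero.2 h1)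
  have hterm : ∀ b c : ℕ, z ^ (b + p ^ (j + 1) * c) ^ 2 = z ^ b ^ 2 * (w ^ b) ^ c := fun b c => by
    have : (b + p ^ (j + 1) * c) ^ 2 =
        b ^ 2 + 2 * p ^ (j + 1) * b * c + (p ^ (j + 1)) ^ 2 * c ^ 2 := by ring
    rw [this, pow_add, pow_add, pow_mul z ((p ^ (j + 1)) ^ 2), hz1, one_pow, mul_one, hw]
    simp only [pow_mul]
  rw [show p ^ (j + 2) = p * p ^ (j + 1) by ring, sum_range_mul_eq, Finset.sum_comm]
  simp only [hterm, ← Finset.mul_sum, hgeom]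
  rw [pow_succ p j, sum_range_mul_eq, Finset.mul_sum]
  refine Finset.sum_congr rfl fun c _ => ?_
  rw [Finset.sum_eq_single_of_mem 0 (Finset.mem_range.2 hp.pos)]
  · rw [if_pos ⟨c, by ring⟩, mul_comm, zero_add, mul_pow, pow_mul]
  · intro b hb hb0
    rw [if_neg, mul_zero]
    rw [Nat.dvd_add_left (dvd_mul_right p c)]
    exact Nat.not_dvd_of_pos_of_lt (Nat.pos_of_ne_zero hb0) (Finset.mem_range.1 hb)

/-- Counting square roots by 1 + χ(x), with χ the quadratic character, turns both sums into Gauss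
sums of χ; the substitution x ↦ 2x then extracts χ(2). -/
theorem sum_pow_two_mul_sq_prime {p : ℕ} (hp : p.Prime) (hp2 : p ≠ 2) {z : ℂ}
    (hz : IsPrimitiveRoot z p) :
    ∑ a ∈ Finset.range p, (z ^ 2) ^ a ^ 2 = jacobiSym 2 p * ∑ a ∈ Finset.range p, z ^ a ^ 2 := by
  have : Fact p.Prime := ⟨hp⟩
  have hchar : ringChar (ZMod p) ≠ 2 := by rwa [ZMod.ringChar_zmod_n]
  let F : ZMod p → ℂ := fun x => z ^ x.val
  have hF : ∀ n : ℕ, z ^ n = F n := fun n => by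
    simp only [F, ZMod.val_natCast]
    exact pow_eq_pow_mod n hz.pow_eq_one
  have hF0 : ∑ x, F x = 0 := by
    rw [sum_zmod_eq_sum_range p fun a => z ^ a]
    exact hz.geom_sum_eq_zero hp.one_lt
  have hsum : ∀ c : ZMod p, c ≠ 0 → ∑ a : ZMod p, F (c * a ^ 2) =
      ∑ x : ZMod p, (quadraticChar (ZMod p) x : ℂ) * F (c * x) := fun c hc => by
    have h1 : ∑ x, F (c * x) = 0 := by
      rw [← hF0]
      exact Fintype.sum_equiv (Equiv.mulLeft₀ c hc) _ _ fun x => rfl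
    rw [← Finset.sum_fiberwise (Finset.univ) (fun a : ZMod p => a ^ 2), ← add_zero (∑ x, _ * _),
      ← h1, ← Finset.sum_add_distrib]
    refine Finset.sum_congr rfl fun x _ => ?_
    rw [Finset.sum_congr rfl fun a ha => by rw [(Finset.mem_filter.1 ha).2], Finset.sum_const,
      nsmul_eq_mul]
    have h2 := quadraticChar_card_sqrts hchar x
    have h3 : {y : ZMod p | y ^ 2 = x}.toFinset = Finset.univ.filter fun y => y ^ 2 = x := by
      ext; simp
    rw [h3] at h2
    have h4 : ((Finset.univ.filter fun y : ZMod p => y ^ 2 = x).card : ℂ) =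
        quadraticChar (ZMod p) x + 1 := by exact_mod_cast congrArg (Int.cast (R := ℂ)) h2
    rw [h4, add_mul, one_mul]
  have h2 : (2 : ZMod p) ≠ 0 := Ring.two_ne_zero hchar
  have hχ : jacobiSym 2 p = quadraticChar (ZMod p) 2 := by
    rw [← jacobiSym.legendreSym.to_jacobiSym, legendreSym]; norm_num
  have hχ2 : (quadraticChar (ZMod p) 2 : ℂ) ^ 2 = 1 := by
    exact_mod_cast congrArg (Int.cast (R := ℂ)) (quadraticChar_sq_one h2)
  have e1 : ∑ a ∈ Finset.range p, z ^ a ^ 2 = ∑ a : ZMod p, F (1 * a ^ 2) := by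
    simp only [hF, Nat.cast_pow, one_mul]
    rw [← sum_zmod_eq_sum_range p fun a => F ((a : ZMod p) ^ 2)]
    simp only [ZMod.natCast_zmod_val]
  have e2 : ∑ a ∈ Finset.range p, (z ^ 2) ^ a ^ 2 = ∑ a : ZMod p, F (2 * a ^ 2) := by
    simp only [← pow_mul]
    simp only [hF, Nat.cast_mul, Nat.cast_pow, Nat.cast_two]
    rw [← sum_zmod_eq_sum_range p fun a => F (2 * (a : ZMod p) ^ 2)]
    simp only [ZMod.natCast_zmod_val]
  rw [e1, e2, hsum 2 h2, hsum 1 one_ne_zero, hχ, Finset.mul_sum]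
  refine Fintype.sum_equiv (Equiv.mulLeft₀ 2 h2) _ _ fun x => ?_
  change _ = (quadraticChar (ZMod p) 2 : ℂ) *
    ((quadraticChar (ZMod p) (2 * x) : ℂ) * F (1 * (2 * x)))
  rw [map_mul, one_mul, Int.cast_mul]
  linear_combination (-(quadraticChar (ZMod p) x : ℂ) * F (2 * x)) * hχ2

/-- Passing from k to k - 2 multiplies both sums by p and leaves the Jacobi symbol unchanged, so the
cases k = 0 and k = 1 suffice. -/
theorem sum_pow_two_mul_sq_prime_pow {p : ℕ} (hp : p.Prime) (hp2 : p ≠ 2) (k : ℕ) {z : ℂ}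
    (hz : IsPrimitiveRoot z (p ^ k)) :
    ∑ a ∈ Finset.range (p ^ k), (z ^ 2) ^ a ^ 2 =
      jacobiSym 2 (p ^ k) * ∑ a ∈ Finset.range (p ^ k), z ^ a ^ 2 := by
  have hcop : Nat.Coprime 2 p := (Nat.coprime_primes Nat.prime_two hp).2 (Ne.symm hp2)
  have hrec : ∀ j : ℕ, ∀ w : ℂ, IsPrimitiveRoot w (p ^ (j + 2)) →
      ∑ a ∈ Finset.range (p ^ (j + 2)), w ^ a ^ 2 =
        p * ∑ b ∈ Finset.range (p ^ j), (w ^ p ^ 2) ^ b ^ 2 := fun j w hw => by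
    refine sum_pow_sq_prime_pow p j hp w ?_ ?_
    · rw [mul_comm, pow_mul]
      refine (hw.pow (pow_pos hp.pos _) ?_).pow_of_coprime 2 hcop
      ring
    · rw [hw.pow_eq_one_iff_dvd]
      exact ⟨p ^ j, by ring⟩
  induction k using Nat.strong_induction_on generalizing z with
  | _ k ih =>
    match k with
    | 0 => simp
    | 1 => simpa using sum_pow_two_mul_sq_prime hp hp2 (by simpa using hz)
    | j + 2 =>
      have hz2 : IsPrimitiveRoot (z ^ 2) (p ^ (j + 2)) :=
        hz.pow_of_coprime 2 (hcop.pow_right _)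
      have hzp : IsPrimitiveRoot (z ^ p ^ 2) (p ^ j) :=
        hz.pow (pow_pos hp.pos _) (by ring)
      have h1 := ih j (by omega) hzp
      rw [hrec j z hz, hrec j _ hz2, ← pow_mul, mul_comm 2, pow_mul, h1]
      have h2 : jacobiSym 2 (p ^ (j + 2)) = jacobiSym 2 (p ^ j) := by
        rw [jacobiSym.pow_right, jacobiSym.pow_right, pow_add, jacobiSym.sq_one, mul_one]
        exact Nat.Coprime.symm (by simpa using hcop.symm)
      rw [h2]; ring

/-- The quadratic Gauss sum `∑ ζ^{a²}` modulo `2^k`. -/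
def cyclicSum (k : ℕ) (z : ℂ) : ℂ := ∑ a ∈ Finset.range (2 ^ k), z ^ a ^ 2

theorem sum_range_two_pow_succ {M : Type*} [AddCommMonoid M] (f : ℕ → M) (k : ℕ) :
    ∑ a ∈ Finset.range (2 ^ (k + 1)), f a = ∑ a ∈ Finset.range (2 ^ k), (f a + f (a + 2 ^ k)) := by
  rw [pow_succ', two_mul, Finset.sum_range_add, Finset.sum_add_distrib]
  simp only [add_comm (2 ^ k)]

/-- The summand has period 2^k, as (a + 2^k)² ≡ a² modulo 2^(k+1). -/
theorem cyclicSum_succ {k : ℕ} (hk : 0 < k) {z : ℂ} (hz : z ^ 2 ^ (k + 1) = 1) :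
    cyclicSum (k + 1) z = 2 * cyclicSum k z := by
  rw [cyclicSum, sum_range_two_pow_succ, cyclicSum, Finset.mul_sum]
  refine Finset.sum_congr rfl fun a _ => ?_
  obtain ⟨j, rfl⟩ := Nat.exists_eq_add_one.2 hk
  rw [show (a + 2 ^ (j + 1)) ^ 2 = a ^ 2 + 2 ^ (j + 1 + 1) * (a + 2 ^ j) by ring, pow_add z,
    pow_mul z, hz]
  ring

theorem e_eighth_sq : e (1 / 8) ^ 2 = Complex.I := by
  refine Eq.trans ?_ Complex.exp_pi_div_two_mul_I
  rw [← e_nat_mul, e]; congr 1; push_cast; ring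

theorem sqrt_two_mul_e_eighth : (√2 : ℂ) * e (1 / 8) = 1 + Complex.I := by
  have h : e (1 / 8) = Real.cos (Real.pi / 4) + Real.sin (Real.pi / 4) * Complex.I := by
    rw [e, Complex.ofReal_cos, Complex.ofReal_sin, ← Complex.exp_mul_I]
    congr 1; push_cast; ring
  have h2 : (√2 : ℂ) * √2 = 2 := by
    rw [← Complex.ofReal_mul, Real.mul_self_sqrt zero_le_two]; norm_num
  rw [h, Real.cos_pi_div_four, Real.sin_pi_div_four]
  push_cast
  linear_combination (1 / 2 * (1 + Complex.I)) * h2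

/-- For v = e(t/8) the two sums are 2(1 + v²) and 2v, so the claim is v + v⁻¹ = 2cos(πt/4) = √2
χ₈(t). -/
theorem cyclicSum_two (t : ℤ) (ht : Odd t) :
    cyclicSum 2 (e (t / 8) ^ 2) = √2 * ZMod.χ₈ t * cyclicSum 2 (e (t / 8)) := by
  obtain ⟨r, m, hr, rfl⟩ : ∃ (r : ℕ) (m : ℤ), (r = 1 ∨ r = 3 ∨ r = 5 ∨ r = 7) ∧ t = r + 8 * m := by
    refine ⟨(t % 8).toNat, t / 8, ?_, ?_⟩ <;> rw [Int.odd_iff] at ht <;> omega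
  have hz : e (((r + 8 * m : ℤ) : ℝ) / 8) = e (1 / 8) ^ r := by
    rw [← e_nat_mul, ← mul_one (e (_ * _)), ← e_intCast m, ← e_add]
    congr 1; push_cast; ring
  have hχ : ZMod.χ₈ ((r + 8 * m : ℤ) : ZMod 8) = ZMod.χ₈ (r : ZMod 8) := by
    congr 1
    have : (8 : ZMod 8) = 0 := rfl
    push_cast
    rw [this, zero_mul, add_zero]
  have h2 := e_eighth_sq
  have hs := sqrt_two_mul_e_eighth
  have hI := Complex.I_sq
  rw [hz, hχ]
  generalize e (1 / 8) = w at *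
  have h4 : w ^ 4 = -1 := by rw [show w ^ 4 = (w ^ 2) ^ 2 by ring, h2, hI]
  have key : 1 + (w ^ r) ^ 2 = √2 * ZMod.χ₈ (r : ZMod 8) * w ^ r := by
    rcases hr with rfl | rfl | rfl | rfl
    · rw [show ZMod.χ₈ ((1 : ℕ) : ZMod 8) = 1 from rfl]
      push_cast
      linear_combination h2 - hs
    · rw [show ZMod.χ₈ ((3 : ℕ) : ZMod 8) = -1 from rfl]
      push_cast
      linear_combination w ^ 2 * h4 + w ^ 2 * hs + Complex.I * h2 + hI
    · rw [show ZMod.χ₈ ((5 : ℕ) : ZMod 8) = -1 from rfl]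
      push_cast
      linear_combination (w ^ 6 - w ^ 2) * h4 + w ^ 4 * hs + (1 + Complex.I) * h4 + h2
    · rw [show ZMod.χ₈ ((7 : ℕ) : ZMod 8) = 1 from rfl]
      push_cast
      linear_combination (w ^ 10 - w ^ 6 + w ^ 2) * h4 - w ^ 6 * hs - (1 + Complex.I) * w ^ 2 * h4
        + Complex.I * h2 + hI
  have h4r : (w ^ r) ^ 4 = -1 := by
    rw [← pow_mul, mul_comm, pow_mul, h4]
    exact Odd.neg_one_pow (by rcases hr with rfl | rfl | rfl | rfl <;> decide)
  generalize w ^ r = v at *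
  generalize ZMod.χ₈ (r : ZMod 8) = s at *
  norm_num [cyclicSum, Finset.sum_range_succ, ← pow_mul]
  have h8 : v ^ 8 = 1 := by rw [show v ^ 8 = (v ^ 4) ^ 2 by ring, h4r]; norm_num
  rw [h4r, h8, show v ^ 9 = v ^ 8 * v by ring, show v ^ 18 = (v ^ 8) ^ 2 * v ^ 2 by ring, h8]
  linear_combination 2 * key

/-- In the induction step the sums for z and z² are expressed through those for z⁴ and z² one level
lower; the known relation is thus inverted, which is harmless since (√2 χ₈)² = 2. The exponent
starts at 2: modulo 2 the squared sum vanishes. -/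
theorem cyclicSum_sq (k : ℕ) (t : ℤ) (ht : Odd t) :
    cyclicSum (k + 2) (e (t / 2 ^ (k + 3)) ^ 2) =
      √2 * ZMod.χ₈ t * cyclicSum (k + 2) (e (t / 2 ^ (k + 3))) := by
  induction k with
  | zero => convert cyclicSum_two t ht using 3 <;> norm_num
  | succ k ih =>
    have hz2 : e (t / 2 ^ (k + 3)) = e (t / 2 ^ (k + 1 + 3)) ^ 2 := by
      rw [← e_nat_mul]; congr 1; push_cast [pow_succ]; field_simp
    have hz : IsPrimitiveRoot (e (t / 2 ^ (k + 1 + 3))) (2 ^ (k + 4)) := by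
      convert isPrimitiveRoot_e_div t (2 ^ (k + 4)) (by positivity) ?_ using 3
      · push_cast; rfl
      · push_cast
        exact IsCoprime.pow_right (Int.isCoprime_iff_gcd_eq_one.2 (Int.gcd_comm _ _ ▸
          Int.isCoprime_iff_gcd_eq_one.1 (Int.isCoprime_two_left.2 ht)))
    rw [hz2] at ih
    generalize e (t / 2 ^ (k + 1 + 3)) = z at *
    have h1 : cyclicSum (k + 3) (z ^ 2) = 2 * cyclicSum (k + 2) (z ^ 2) := by
      refine cyclicSum_succ (by omega) ?_
      rw [← pow_mul, hz.pow_eq_one_iff_dvd]; exact ⟨1, by ring⟩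
    have h2 : cyclicSum (k + 2) ((z ^ 2) ^ 2) = 2 * cyclicSum (k + 1) ((z ^ 2) ^ 2) := by
      refine cyclicSum_succ (by omega) ?_
      rw [← pow_mul, ← pow_mul, hz.pow_eq_one_iff_dvd]; exact ⟨1, by ring⟩
    have h3 : cyclicSum (k + 3) z = 2 * cyclicSum (k + 1) ((z ^ 2) ^ 2) := by
      have := sum_pow_sq_prime_pow 2 (k + 1) Nat.prime_two z
        (hz.pow (by positivity) (by ring)) ((hz.pow_eq_one_iff_dvd _).2 ⟨2 ^ k, by ring⟩)
      simpa [cyclicSum, ← pow_mul] using this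
    have hs2 : (√2 : ℂ) ^ 2 = 2 := by
      rw [← Complex.ofReal_pow, Real.sq_sqrt zero_le_two]; norm_num
    have hχ2 : (ZMod.χ₈ t : ℂ) ^ 2 = 1 := by
      rw [ZMod.χ₈_int_eq_if_mod_eight]
      rw [Int.odd_iff] at ht
      rw [if_neg (by omega)]
      split_ifs <;> norm_num
    change cyclicSum (k + 3) (z ^ 2) = _ * cyclicSum (k + 3) z
    rw [h1, h3, ← h2, ih]
    linear_combination (-cyclicSum (k + 2) (z ^ 2)) * ((ZMod.χ₈ t : ℂ) ^ 2 * hs2 + 2 * hχ2)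

/-- The Gauss sum of the form `c a² + a b + c b²` modulo `2^k`. -/
def binarySum (c k : ℕ) (z : ℂ) : ℂ :=
  ∑ a ∈ Finset.range (2 ^ k), ∑ b ∈ Finset.range (2 ^ k), z ^ (c * a ^ 2 + a * b + c * b ^ 2)

theorem sum_sum_range_two_pow_succ {M : Type*} [AddCommMonoid M] (f : ℕ → ℕ → M) (k : ℕ) :
    ∑ a ∈ Finset.range (2 ^ (k + 1)), ∑ b ∈ Finset.range (2 ^ (k + 1)), f a b =
      ∑ a ∈ Finset.range (2 ^ k), ∑ b ∈ Finset.range (2 ^ k),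
        ((f a b + f a (b + 2 ^ k)) + (f (a + 2 ^ k) b + f (a + 2 ^ k) (b + 2 ^ k))) := by
  simp only [sum_range_two_pow_succ, Finset.sum_add_distrib]
  abel

theorem binarySum_succ (c k : ℕ) {z : ℂ} (hz : z ^ 2 ^ k = 1) :
    binarySum c (k + 1) z = 4 * binarySum c k z := by
  rw [binarySum, sum_sum_range_two_pow_succ, binarySum, Finset.mul_sum]
  refine Finset.sum_congr rfl fun a _ => ?_
  rw [Finset.mul_sum]
  refine Finset.sum_congr rfl fun b _ => ?_
  have h : ∀ m n, z ^ (m + 2 ^ k * n) = z ^ m := fun m n => by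
    rw [pow_add, pow_mul, hz, one_pow, mul_one]
  rw [show c * a ^ 2 + a * (b + 2 ^ k) + c * (b + 2 ^ k) ^ 2 =
      c * a ^ 2 + a * b + c * b ^ 2 + 2 ^ k * (a + 2 * c * b + c * 2 ^ k) by ring,
    show c * (a + 2 ^ k) ^ 2 + (a + 2 ^ k) * b + c * b ^ 2 =
      c * a ^ 2 + a * b + c * b ^ 2 + 2 ^ k * (b + 2 * c * a + c * 2 ^ k) by ring,
    show c * (a + 2 ^ k) ^ 2 + (a + 2 ^ k) * (b + 2 ^ k) + c * (b + 2 ^ k) ^ 2 =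
      c * a ^ 2 + a * b + c * b ^ 2 +
        2 ^ k * (a + b + 2 * c * b + 2 * c * a + 2 * c * 2 ^ k + 2 ^ k) by ring,
    h, h, h]
  ring

/-- Shifting b or a by half the period multiplies a term by (-1)^a or (-1)^b, so only pairs of even
indices survive. -/
theorem binarySum_add_two (c k : ℕ) {z : ℂ} (hz : z ^ 2 ^ (k + 1) = -1) :
    binarySum c (k + 2) z = 4 * binarySum c k (z ^ 4) := by
  have h : ∀ n, z ^ (2 ^ (k + 1) * n) = (-1) ^ n := fun n => by rw [pow_mul, hz]
  have hterm : ∀ a b : ℕ, z ^ (c * a ^ 2 + a * b + c * b ^ 2) +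
      z ^ (c * a ^ 2 + a * (b + 2 ^ (k + 1)) + c * (b + 2 ^ (k + 1)) ^ 2) +
      (z ^ (c * (a + 2 ^ (k + 1)) ^ 2 + (a + 2 ^ (k + 1)) * b + c * b ^ 2) +
      z ^ (c * (a + 2 ^ (k + 1)) ^ 2 + (a + 2 ^ (k + 1)) * (b + 2 ^ (k + 1)) +
        c * (b + 2 ^ (k + 1)) ^ 2)) =
      (1 + (-1) ^ a) * ((1 + (-1) ^ b) * z ^ (c * a ^ 2 + a * b + c * b ^ 2)) := fun a b => by
    rw [show c * a ^ 2 + a * (b + 2 ^ (k + 1)) + c * (b + 2 ^ (k + 1)) ^ 2 =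
        c * a ^ 2 + a * b + c * b ^ 2 + 2 ^ (k + 1) * (a + 2 * (c * b + c * 2 ^ k)) by ring,
      show c * (a + 2 ^ (k + 1)) ^ 2 + (a + 2 ^ (k + 1)) * b + c * b ^ 2 =
        c * a ^ 2 + a * b + c * b ^ 2 + 2 ^ (k + 1) * (b + 2 * (c * a + c * 2 ^ k)) by ring,
      show c * (a + 2 ^ (k + 1)) ^ 2 + (a + 2 ^ (k + 1)) * (b + 2 ^ (k + 1)) +
          c * (b + 2 ^ (k + 1)) ^ 2 =
        c * a ^ 2 + a * b + c * b ^ 2 +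
          2 ^ (k + 1) * (a + b + 2 * (c * b + c * a + 2 * c * 2 ^ k + 2 ^ k)) by ring,
      pow_add z (c * a ^ 2 + a * b + c * b ^ 2), pow_add z (c * a ^ 2 + a * b + c * b ^ 2),
      pow_add z (c * a ^ 2 + a * b + c * b ^ 2), h, h, h]
    simp only [pow_add (-1 : ℂ), pow_mul (-1 : ℂ), neg_one_sq, one_pow]
    ring
  rw [binarySum, sum_sum_range_two_pow_succ]
  simp only [hterm, ← Finset.mul_sum]
  have hpar : ∀ g : ℕ → ℂ, ∑ a ∈ Finset.range (2 ^ (k + 1)), (1 + (-1) ^ a) * g a =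
      2 * ∑ a ∈ Finset.range (2 ^ k), g (2 * a) := fun g => by
    rw [pow_succ, sum_range_mul_eq, Finset.mul_sum]
    refine Finset.sum_congr rfl fun a _ => ?_
    rw [Finset.sum_range_succ, Finset.sum_range_one]
    simp only [pow_add, pow_mul, neg_one_sq, one_pow, zero_add]
    ring
  simp only [hpar]
  rw [← Finset.mul_sum, ← mul_assoc, binarySum]
  congr 1
  · norm_num
  · refine Finset.sum_congr rfl fun a _ => Finset.sum_congr rfl fun b _ => ?_
    rw [← pow_mul]; congr 1; ring

/-- As for cyclic sums, each step inverts the previous relation. The base z = -1 compares 4 with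
2(-1)^c, so the sign records which of the two planes occurs. -/
theorem binarySum_sq (c : ℕ) (hc : c ≤ 1) (k : ℕ) {z : ℂ} (hz : IsPrimitiveRoot z (2 ^ (k + 1))) :
    binarySum c (k + 1) (z ^ 2) = 2 * (-1) ^ c * binarySum c (k + 1) z := by
  induction k generalizing z with
  | zero =>
    have hz1 : z = -1 := (IsPrimitiveRoot.eq_neg_one_of_two_right (by simpa using hz))
    subst hz1
    interval_cases c <;> norm_num [binarySum, Finset.sum_range_succ]
  | succ k ih =>
    have hz2 : IsPrimitiveRoot (z ^ 2) (2 ^ (k + 1)) := hz.pow (by positivity) (by ring)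
    have hz4 : (z ^ 4) ^ 2 ^ k = 1 := by
      rw [← pow_mul, hz.pow_eq_one_iff_dvd]; exact ⟨1, by ring⟩
    have hneg : z ^ 2 ^ (k + 1) = -1 :=
      (IsPrimitiveRoot.eq_neg_one_of_two_right (hz.pow (by positivity) (by ring)))
    have h1 := ih hz2
    rw [← pow_mul, binarySum_succ c k hz4] at h1
    rw [binarySum_succ c (k + 1) hz2.pow_eq_one, binarySum_add_two c k hneg, h1]
    have : ((-1 : ℂ) ^ c) ^ 2 = 1 := by rw [← pow_mul, mul_comm, pow_mul]; norm_num
    linear_combination (-4 * binarySum c (k + 1) (z ^ 2)) * this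

end Sums

/-! ### The sign of the ratio of the Gauss sums of Q² and Q. -/

section

variable {A : Type*} [AddCommGroup A] {Q : A → ℂˣ}

/-- The Gauss sum of `Q²` is a positive multiple of `κ` times the Gauss sum of `Q`. -/
def HasGaussSign [Fintype A] (Q : A → ℂˣ) (κ : ℤ) : Prop :=
  ∃ C : ℝ, 0 < C ∧ ∑ a, (Q a : ℂ) ^ 2 = κ * C * ∑ a, (Q a : ℂ)

/-- The sum of Q is nonzero, so the sign is determined by Q alone. This gives independence of the
Jordan decomposition. -/
theorem HasGaussSign.eq [Fintype A] (hQ : IsNondegQuadratic Q) {s t : ℤˣ}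
    (hs : HasGaussSign Q s) (ht : HasGaussSign Q t) : s = t := by
  obtain ⟨C, hC, h1⟩ := hs
  obtain ⟨D, hD, h2⟩ := ht
  rw [h1] at h2
  have h3 := mul_right_cancel₀ hQ.sum_ne_zero h2
  have h4 : ((s : ℤ) : ℝ) * C = ((t : ℤ) : ℝ) * D := by exact_mod_cast h3
  rcases Int.units_eq_one_or s with rfl | rfl <;> rcases Int.units_eq_one_or t with rfl | rfl
  · rfl
  · push_cast at h4; linarith
  · push_cast at h4; linarith
  · rfl

/-- Sums of functions that are multiplicative along a Jordan decomposition. -/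
theorem JordanDecomposition.sum_eq_prod [Fintype A] (d : JordanDecomposition Q)
    [∀ i, Fintype (d.component i)] (F : A → ℂ)
    (hF : ∀ x : ∀ i, d.component i, F (d.equiv x) = ∏ i, F (x i)) :
    ∑ a, F a = ∏ i, ∑ x : d.component i, F x := by
  classical
  rw [Finset.prod_univ_sum, Fintype.piFinset_univ]
  exact (Fintype.sum_equiv d.equiv.toEquiv _ _ fun x => (hF x).symm).symm

theorem JordanDecomposition.hasGaussSign [Fintype A] (d : JordanDecomposition Q)
    (hQ : IsQuadratic Q) [∀ i, Fintype (d.component i)] (κ : Fin d.n → ℤ)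
    (h : ∀ i, HasGaussSign (fun a : d.component i => Q a) (κ i)) :
    HasGaussSign Q (∏ i, κ i) := by
  choose C hC h using h
  refine ⟨∏ i, C i, Finset.prod_pos fun i _ => hC i, ?_⟩
  rw [d.sum_eq_prod (fun a => (Q a : ℂ)), d.sum_eq_prod (fun a => (Q a : ℂ) ^ 2),
    Finset.prod_congr rfl fun i _ => h i]
  · simp only [Finset.prod_mul_distrib]
    push_cast
    rfl
  · intro x
    rw [d.map_equiv hQ, Units.coe_prod, Finset.prod_pow]
  · intro x
    rw [d.map_equiv hQ, Units.coe_prod]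

theorem JordanDecomposition.card_eq_prod [Finite A] (d : JordanDecomposition Q) :
    Nat.card A = ∏ i, Nat.card (d.component i) := by
  rw [← Nat.card_congr d.equiv.toEquiv, Nat.card_pi]

theorem map_equiv_zmod (hQ : IsQuadratic Q) {n : ℕ} [NeZero n] (f : ZMod n ≃+ A) (x : ZMod n) :
    (Q (f x) : ℂ) = (Q (f 1) : ℂ) ^ x.val ^ 2 := by
  have : f x = x.val • f 1 := by
    rw [← map_nsmul, nsmul_one, ZMod.natCast_zmod_val]
  rw [this, hQ.map_nsmul, Units.val_pow_eq_pow_val]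

theorem sum_cyclic [Fintype A] (hQ : IsQuadratic Q) {n : ℕ} [NeZero n] (f : ZMod n ≃+ A) :
    ∑ a, (Q a : ℂ) = ∑ m ∈ Finset.range n, (Q (f 1) : ℂ) ^ m ^ 2 := by
  rw [← sum_zmod_eq_sum_range n fun m => (Q (f 1) : ℂ) ^ m ^ 2]
  exact (Fintype.sum_equiv f.toEquiv _ _ fun x => (map_equiv_zmod hQ f x).symm).symm

theorem sum_sq_cyclic [Fintype A] (hQ : IsQuadratic Q) {n : ℕ} [NeZero n] (f : ZMod n ≃+ A) :
    ∑ a, (Q a : ℂ) ^ 2 = ∑ m ∈ Finset.range n, ((Q (f 1) : ℂ) ^ 2) ^ m ^ 2 := by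
  rw [← sum_zmod_eq_sum_range n fun m => ((Q (f 1) : ℂ) ^ 2) ^ m ^ 2]
  refine (Fintype.sum_equiv f.toEquiv _ _ fun x => ?_).symm
  rw [AddEquiv.toEquiv_eq_coe, AddEquiv.coe_toEquiv, map_equiv_zmod hQ f x, ← pow_mul, ← pow_mul,
    mul_comm]

theorem JordanSymbol.Describes.hasGaussSign_odd [Fintype A] (hQ : IsQuadratic Q) {p k : ℕ}
    {ε : ℤˣ} (h : (JordanSymbol.odd p k ε).Describes Q) :
    HasGaussSign Q (jacobiSym 2 (Nat.card A)) := by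
  obtain ⟨hp, hp2, hk, f, u, hu, -, hQ1⟩ := h
  have : NeZero (p ^ k) := ⟨pow_ne_zero _ hp.ne_zero⟩
  have hcard : Nat.card A = p ^ k := by rw [← Nat.card_congr f.toEquiv, Nat.card_zmod]
  have hz : IsPrimitiveRoot (Q (f 1) : ℂ) (p ^ k) := by
    rw [hQ1]
    convert isPrimitiveRoot_e_div u (p ^ k) (pow_ne_zero _ hp.ne_zero) ?_ using 3
    · push_cast; rfl
    · push_cast; exact hu.pow_right
  refine ⟨1, one_pos, ?_⟩
  rw [sum_sq_cyclic hQ f, sum_cyclic hQ f, hcard, sum_pow_two_mul_sq_prime_pow hp hp2 k hz]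
  simp

theorem JordanSymbol.Describes.hasGaussSign_two [Fintype A] (hQ : IsQuadratic Q) {k : ℕ}
    {t : ZMod 8} {ε : ℤˣ} (h : (JordanSymbol.two k t ε).Describes Q) (hk1 : k ≠ 1) :
    HasGaussSign Q ε := by
  obtain ⟨hk, hχ, f, u, hut, hQ1⟩ := h
  have hu := odd_of_χ₈_eq hχ hut
  obtain ⟨k, rfl⟩ := Nat.exists_eq_add_of_le' (show 2 ≤ k by omega)
  refine ⟨√2, by positivity, ?_⟩
  rw [sum_sq_cyclic hQ f, sum_cyclic hQ f, hQ1, ← hχ, ← hut]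
  have := cyclicSum_sq k u hu
  rw [mul_comm (√2 : ℂ)] at this
  exact this

theorem map_linearComb_nat (hQ : IsQuadratic Q) (m n : ℕ) (x y : A) :
    Q (m • x + n • y) = Q x ^ (m ^ 2) * Q y ^ (n ^ 2) * assocForm Q x y ^ (m * n) := by
  have := hQ.map_linearComb m n x y
  rw [natCast_zsmul, natCast_zsmul] at this
  rw [this]
  norm_cast

theorem JordanSymbol.Describes.hasGaussSign_twoII [Fintype A] (hQ : IsQuadratic Q) {k : ℕ}
    {ε : ℤˣ} (h : (JordanSymbol.twoII k ε).Describes Q) : HasGaussSign Q ε := by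
  obtain ⟨hk, f, hB, h1, h2⟩ := h
  obtain ⟨k, rfl⟩ := Nat.exists_eq_add_one.2 hk
  -- Both planes are ca² + ab + cb² with c in {0,1} and ε = (-1)^c.
  obtain ⟨c, hc, hcε, hx, hy⟩ : ∃ c : ℕ, c ≤ 1 ∧ ((ε : ℤ) : ℂ) = (-1) ^ c ∧
      (Q (f (1, 0)) : ℂ) = e (1 / 2 ^ (k + 1)) ^ c ∧
      (Q (f (0, 1)) : ℂ) = e (1 / 2 ^ (k + 1)) ^ c := by
    rcases Int.units_eq_one_or ε with rfl | rfl
    · exact ⟨0, zero_le_one, by simp, by simp [(h1 rfl).1], by simp [(h1 rfl).2]⟩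
    · exact ⟨1, le_rfl, by simp, by rw [(h2 rfl).1, pow_one], by rw [(h2 rfl).2, pow_one]⟩
  have hz : IsPrimitiveRoot (e (1 / 2 ^ (k + 1))) (2 ^ (k + 1)) := by
    simpa using isPrimitiveRoot_e (2 ^ (k + 1)) (by positivity)
  generalize e (1 / 2 ^ (k + 1)) = z at *
  have hval : ∀ x : ZMod (2 ^ (k + 1)) × ZMod (2 ^ (k + 1)), (Q (f x) : ℂ) =
      z ^ (c * x.1.val ^ 2 + x.1.val * x.2.val + c * x.2.val ^ 2) := fun x => by
    have hfx : f x = x.1.val • f (1, 0) + x.2.val • f (0, 1) := by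
      rw [← map_nsmul, ← map_nsmul, ← map_add]
      congr 1
      ext <;> simp
    rw [hfx, map_linearComb_nat hQ]
    push_cast
    rw [hx, hy, hB, ← pow_mul, ← pow_mul, ← pow_add, ← pow_add]
    congr 1; ring
  have hsum : ∀ j : ℕ, ∑ a, (Q a : ℂ) ^ j = binarySum c (k + 1) (z ^ j) := fun j => by
    rw [← Fintype.sum_equiv f.toEquiv
      (fun x => (z ^ j) ^ (c * x.1.val ^ 2 + x.1.val * x.2.val + c * x.2.val ^ 2)) _ fun x => ?_]
    · rw [Fintype.sum_prod_type, binarySum,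
        ← sum_zmod_eq_sum_range (2 ^ (k + 1)) fun a => ∑ b ∈ Finset.range (2 ^ (k + 1)),
          (z ^ j) ^ (c * a ^ 2 + a * b + c * b ^ 2)]
      refine Finset.sum_congr rfl fun a _ => ?_
      exact sum_zmod_eq_sum_range (2 ^ (k + 1)) fun b =>
          (z ^ j) ^ (c * a.val ^ 2 + a.val * b + c * b ^ 2)
    · rw [AddEquiv.toEquiv_eq_coe, AddEquiv.coe_toEquiv, hval, ← pow_mul, ← pow_mul, mul_comm]
  have h1 := hsum 1
  simp only [pow_one] at h1
  refine ⟨2, two_pos, ?_⟩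
  rw [hsum, h1, binarySum_sq c hc k hz, hcε]
  push_cast; ring

/-- The decisive case is ℤ/2^k: Q² takes the value e(t 2^(k-2)) on the element 2^(k-1) of order two,
which is 1 exactly when k ≥ 2. -/
theorem JordanSymbol.Describes.sq_eq_one_of_two_smul (hQ : IsQuadratic Q) {S : JordanSymbol}
    (h : S.Describes Q) (hS : ¬ S.IsTwoT) (x : A) (hx : 2 • x = 0) : Q x ^ 2 = 1 := by
  rcases S with ⟨p, k, ε⟩ | ⟨k, t, ε⟩ | ⟨k, ε⟩
  · obtain ⟨hp, hp2, hk, f, -⟩ := h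
    have h1 : p ^ k • x = 0 := by
      rw [← f.apply_symm_apply x, ← map_nsmul]; simp
    obtain ⟨j, hj⟩ : Odd (p ^ k) := (hp.odd_of_ne_two hp2).pow
    rw [hj, add_smul, mul_comm, mul_smul, hx, smul_zero, zero_add, one_smul] at h1
    rw [h1, hQ.map_zero, one_pow]
  · obtain ⟨hk, hχ, f, u, hut, hQ1⟩ := h
    have hk1 : k ≠ 1 := hS
    obtain ⟨m, hm⟩ := ZMod.intCast_surjective (f.symm x)
    have hxm : x = m • f 1 := by rw [ZMod.zsmul_equiv_one, hm, f.apply_symm_apply]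
    have h2 : ((2 ^ k : ℕ) : ℤ) ∣ 2 * m := by
      rw [← ZMod.intCast_zmod_eq_zero_iff_dvd, ← map_eq_zero_iff f f.injective,
        ← ZMod.zsmul_equiv_one, mul_smul, ← hxm]
      exact_mod_cast hx
    have h3 : Q (f 1) ^ 2 ^ (k + 1) = 1 := by
      ext
      rw [Units.val_pow_eq_pow_val, hQ1, ← e_nat_mul, Units.val_one, ← e_intCast u]
      congr 1; push_cast; field_simp
    rw [hxm, hQ.map_zsmul, ← zpow_natCast, ← zpow_mul]
    refine zpow_eq_one_of_dvd h3 ?_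
    obtain ⟨k, rfl⟩ := Nat.exists_eq_add_of_le' (show 2 ≤ k by omega)
    obtain ⟨c, hc⟩ := h2
    have hm' : m = 2 ^ (k + 1) * c := by
      push_cast [pow_succ] at hc ⊢; linarith
    exact ⟨2 ^ k * c ^ 2, by rw [hm']; push_cast; ring⟩
  · obtain ⟨hk, f, hB, h1, h2⟩ := h
    have hroot : ∀ v : ℂˣ, (v : ℂ) = e (1 / 2 ^ k) → v ^ 2 ^ k = 1 := fun v hv => by
      ext
      rw [Units.val_pow_eq_pow_val, hv, ← e_nat_mul, Units.val_one, ← e_one]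
      congr 1; push_cast; field_simp
    have hQs : Q (f (1, 0)) ^ 2 ^ k = 1 ∧ Q (f (0, 1)) ^ 2 ^ k = 1 := by
      rcases Int.units_eq_one_or ε with rfl | rfl
      · rw [(h1 rfl).1, (h1 rfl).2]; simp
      · exact ⟨hroot _ (h2 rfl).1, hroot _ (h2 rfl).2⟩
    obtain ⟨m, hm⟩ := ZMod.intCast_surjective (f.symm x).1
    obtain ⟨n, hn⟩ := ZMod.intCast_surjective (f.symm x).2
    have hxm : x = linearComb (f (1, 0)) (f (0, 1)) (m, n) := by
      rw [ZMod.linearComb_equiv, hm, hn, f.apply_symm_apply]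
    have h2x : linearComb (f (1, 0)) (f (0, 1)) (2 * m, 2 * n) = 0 := by
      rw [← hx, hxm, ← map_nsmul]; simp
    rw [ZMod.linearComb_equiv, map_eq_zero_iff f f.injective, Prod.mk_eq_zero,
      ZMod.intCast_zmod_eq_zero_iff_dvd, ZMod.intCast_zmod_eq_zero_iff_dvd] at h2x
    obtain ⟨k, rfl⟩ := Nat.exists_eq_add_one.2 hk
    obtain ⟨⟨c, hc⟩, ⟨d, hd⟩⟩ := h2x
    have hm' : m = 2 ^ k * c := by push_cast [pow_succ] at hc ⊢; linarith
    have hn' : n = 2 ^ k * d := by push_cast [pow_succ] at hd ⊢; linarith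
    rw [hxm, linearComb_apply, hQ.map_linearComb, mul_pow, mul_pow]
    simp only [← zpow_natCast, ← zpow_mul]
    rw [zpow_eq_one_of_dvd hQs.1 ⟨2 ^ k * c ^ 2, by rw [hm']; push_cast; ring⟩,
      zpow_eq_one_of_dvd hQs.2 ⟨2 ^ k * d ^ 2, by rw [hn']; push_cast; ring⟩,
      zpow_eq_one_of_dvd (hroot _ hB) ⟨2 ^ k * c * d, by rw [hm', hn']; push_cast; ring⟩,
      one_mul, one_mul]

theorem JordanSymbol.Describes.exists_sq_eq_neg_one {S : JordanSymbol}
    (h : S.Describes Q) (hS : S.IsTwoT) : ∃ x, 2 • x = 0 ∧ Q x ^ 2 = -1 := by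
  rcases S with ⟨p, k, ε⟩ | ⟨k, t, ε⟩ | ⟨k, ε⟩
  · exact hS.elim
  · obtain ⟨hk, hχ, f, u, hut, hQ1⟩ := h
    have hk1 : k = 1 := hS
    subst hk1
    refine ⟨f 1, ?_, ?_⟩
    · rw [← map_nsmul, nsmul_one, map_eq_zero_iff f f.injective]
      exact ZMod.natCast_self 2
    · obtain ⟨j, hj⟩ := odd_of_χ₈_eq hχ hut
      ext
      rw [Units.val_pow_eq_pow_val, hQ1, ← e_nat_mul, Units.val_neg, Units.val_one, ← e_half,
        ← one_mul (e (1 / 2)), ← e_intCast j, ← e_add]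
      congr 1; rw [hj]; push_cast; ring
  · exact hS.elim

theorem JordanDecomposition.sq_eq_one_of_two_smul (d : JordanDecomposition Q) (hQ : IsQuadratic Q)
    (hd : ¬ d.ContainsTwoT) (x : A) (hx : 2 • x = 0) : Q x ^ 2 = 1 := by
  rw [d.map_eq_prod hQ, ← Finset.prod_pow]
  refine Finset.prod_eq_one fun i _ => ?_
  refine JordanSymbol.Describes.sq_eq_one_of_two_smul (hQ.restrict _) (d.describes i) (fun h => hd ⟨i, h⟩)
    (d.equiv.symm x i) ?_
  rw [← Pi.smul_apply, ← map_nsmul, hx, map_zero, Pi.zero_apply]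

theorem JordanDecomposition.exists_sq_eq_neg_one (d : JordanDecomposition Q)
    (hd : d.ContainsTwoT) : ∃ x, 2 • x = 0 ∧ Q x ^ 2 = -1 := by
  obtain ⟨i, hi⟩ := hd
  obtain ⟨x, hx, hx'⟩ := JordanSymbol.Describes.exists_sq_eq_neg_one (d.describes i) hi
  exact ⟨x, by exact_mod_cast congrArg Subtype.val hx, hx'⟩

theorem neg_one_ne_one_units : (-1 : ℂˣ) ≠ 1 := by
  rw [Ne, ← Units.val_inj]; norm_num

theorem JordanDecomposition.hasGaussSign_of_even [Fintype A] (d : JordanDecomposition Q)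
    (hQ : IsQuadratic Q) (hA : ∀ a : A, ∃ k : ℕ, 2 ^ k • a = 0)
    (h2 : ∀ x : A, 2 • x = 0 → Q x ^ 2 = 1) : HasGaussSign Q d.sign := by
  classical
  have hT : ¬ d.ContainsTwoT := fun hd => by
    obtain ⟨x, hx, hx'⟩ := d.exists_sq_eq_neg_one hd
    exact neg_one_ne_one_units (hx'.symm.trans (h2 x hx))
  have : ∀ i, Fintype (d.component i) := fun i => Fintype.ofFinite _
  rw [JordanDecomposition.sign, Units.coe_prod]
  refine d.hasGaussSign hQ _ fun i => ?_
  have hi := d.describes i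
  have hTi : ¬ (d.symbol i).IsTwoT := fun h => hT ⟨i, h⟩
  generalize d.symbol i = S at hi hTi
  rcases S with ⟨p, k, ε⟩ | ⟨k, t, ε⟩ | ⟨k, ε⟩
  · obtain ⟨hp, hp2, hk, f, -⟩ := hi
    obtain ⟨m, hm⟩ := hA (f 1)
    have hm' : (2 ^ m) • f 1 = 0 := Subtype.ext (by exact_mod_cast hm)
    rw [← map_nsmul, map_eq_zero_iff f f.injective, nsmul_one, ZMod.natCast_eq_zero_iff] at hm'
    have := hp.dvd_of_dvd_pow ((dvd_pow_self p hk.ne').trans hm')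
    exact absurd ((Nat.prime_dvd_prime_iff_eq hp Nat.prime_two).1 this) hp2
  · exact hi.hasGaussSign_two (hQ.restrict _) hTi
  · exact hi.hasGaussSign_twoII (hQ.restrict _)

theorem jacobiSym_prod_right {ι : Type*} (s : Finset ι) (a : ℤ) (n : ι → ℕ) (hn : ∀ i, n i ≠ 0) :
    jacobiSym a (∏ i ∈ s, n i) = ∏ i ∈ s, jacobiSym a (n i) := by
  classical
  induction s using Finset.induction_on with
  | empty => simp
  | insert i s hi ih =>
    have : NeZero (n i) := ⟨hn i⟩
    have : NeZero (∏ j ∈ s, n j) := ⟨Finset.prod_ne_zero_iff.2 fun j _ => hn j⟩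
    rw [Finset.prod_insert hi, Finset.prod_insert hi, jacobiSym.mul_right, ih]

theorem JordanDecomposition.hasGaussSign_of_odd [Fintype A] (d : JordanDecomposition Q)
    (hQ : IsQuadratic Q) (hA : ∀ a : A, ∃ n : ℕ, Odd n ∧ n • a = 0) :
    HasGaussSign Q (jacobiSym 2 (Nat.card A)) := by
  have : ∀ i, Fintype (d.component i) := fun i => Fintype.ofFinite _
  rw [d.card_eq_prod, jacobiSym_prod_right _ _ _ fun i => Nat.card_pos.ne']
  refine d.hasGaussSign hQ _ fun i => ?_
  have hi := d.describes i
  generalize d.symbol i = S at hi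
  have key : ∀ (k : ℕ) (a : d.component i), 0 < k → ¬ ∀ n : ℕ, n • a = 0 → 2 ^ k ∣ n := by
    intro k a hk h
    obtain ⟨n, hn, hna⟩ := hA a
    have h1 := h n (Subtype.ext (by exact_mod_cast hna))
    exact Nat.not_even_iff_odd.2 hn (even_iff_two_dvd.2 ((dvd_pow_self 2 hk.ne').trans h1))
  rcases S with ⟨p, k, ε⟩ | ⟨k, t, ε⟩ | ⟨k, ε⟩
  · exact hi.hasGaussSign_odd (hQ.restrict _)
  · obtain ⟨hk, -, f, -⟩ := hi
    refine absurd (fun n hn => ?_) (key k (f 1) hk)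
    rwa [← map_nsmul, map_eq_zero_iff f f.injective, nsmul_one, ZMod.natCast_eq_zero_iff] at hn
  · obtain ⟨hk, f, -⟩ := hi
    refine absurd (fun n hn => ?_) (key k (f (1, 0)) hk)
    rw [← map_nsmul, map_eq_zero_iff f f.injective, Prod.smul_mk, Prod.mk_eq_zero, nsmul_one,
      ZMod.natCast_eq_zero_iff] at hn
    exact hn.1

end

/-! ### Even and odd parts; evaluation of the partial Gauss sum. -/

section Parts

variable {Γ : Type*} [AddCommGroup Γ] {Q : Γ → ℂˣ}

theorem assocForm_even_odd (hQ : IsQuadratic Q) {a b : Γ} (ha : a ∈ evenPart Γ)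
    (hb : b ∈ oddPart Γ) : assocForm Q a b = 1 := by
  obtain ⟨k, hk⟩ := ha
  obtain ⟨n, hn, hnb⟩ := hb
  have h1 : assocForm Q a b ^ 2 ^ k = 1 := by
    rw [← hQ.assoc_nsmul_left, hk, hQ.assoc_zero_left]
  have h2 : assocForm Q a b ^ n = 1 := by
    rw [← hQ.assoc_nsmul_right, hnb, hQ.assoc_zero_right]
  have h3 := pow_gcd_eq_one.2 ⟨h1, h2⟩
  rwa [Nat.Coprime.gcd_eq_one ((Nat.coprime_two_left.2 hn).pow_left k), pow_one] at h3

theorem exists_even_add_odd [Finite Γ] (a : Γ) :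
    ∃ x ∈ evenPart Γ, ∃ y ∈ oddPart Γ, a = x + y := by
  obtain ⟨k, m, hm, hN⟩ := Nat.exists_eq_two_pow_mul_odd (Nat.card_pos (α := Γ)).ne'
  have hcop : IsCoprime ((2 ^ k : ℕ) : ℤ) (m : ℤ) :=
    Nat.isCoprime_iff_coprime.2 ((Nat.coprime_two_left.2 hm).pow_left k)
  have hNa : (2 ^ k * m) • a = 0 := by rw [← hN]; exact card_nsmul_eq_zero'
  obtain ⟨u, v, huv⟩ := hcop
  refine ⟨v • m • a, ⟨k, ?_⟩, u • 2 ^ k • a, ⟨m, hm, ?_⟩, ?_⟩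
  · rw [smul_comm, ← mul_smul, hNa, smul_zero]
  · rw [smul_comm, ← mul_smul, mul_comm, hNa, smul_zero]
  · rw [← natCast_zsmul, ← natCast_zsmul, ← mul_smul, ← mul_smul, ← add_smul, add_comm, huv,
      one_smul]

theorem nondegOn_evenPart [Finite Γ] (hQ : IsNondegQuadratic Q) : NondegOn Q (evenPart Γ) := by
  refine fun a ha h => hQ.nondeg a fun b => ?_
  obtain ⟨x, hx, y, hy, rfl⟩ := exists_even_add_odd b
  rw [hQ.assoc_add_right, h x hx, assocForm_even_odd hQ.isQuadratic ha hy, one_mul]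

theorem nondegOn_oddPart [Finite Γ] (hQ : IsNondegQuadratic Q) : NondegOn Q (oddPart Γ) := by
  refine fun a ha h => hQ.nondeg a fun b => ?_
  obtain ⟨x, hx, y, hy, rfl⟩ := exists_even_add_odd b
  rw [hQ.assoc_add_right, h y hy, assocForm_comm, assocForm_even_odd hQ.isQuadratic hx ha, one_mul]

theorem bijective_even_add_odd [Finite Γ] :
    Function.Bijective fun v : evenPart Γ × oddPart Γ => (v.1 : Γ) + v.2 := by
  let g : evenPart Γ × oddPart Γ →+ Γ := (evenPart Γ).subtype.coprod (oddPart Γ).subtype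
  have hinj : Function.Injective g := by
    rw [injective_iff_map_eq_zero]
    rintro ⟨⟨x, hx⟩, ⟨y, hy⟩⟩ h
    have hxy : x + y = 0 := h
    have hx0 : x = 0 := by
      obtain ⟨k, hk⟩ := hx
      obtain ⟨n, hn, hny⟩ := hy
      have hnx : n • x = 0 := by
        rw [eq_neg_of_add_eq_zero_left hxy, smul_neg, hny, neg_zero]
      have h1 := addOrderOf_dvd_of_nsmul_eq_zero hk
      have h2 := addOrderOf_dvd_of_nsmul_eq_zero hnx
      have h3 := Nat.Coprime.eq_one_of_dvd
        (((Nat.coprime_two_left.2 hn).pow_left k).coprime_dvd_left h1) h2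
      exact AddMonoid.addOrderOf_eq_one_iff.1 h3
    subst hx0
    rw [zero_add] at hxy
    subst hxy
    rfl
  refine ⟨hinj, fun a => ?_⟩
  obtain ⟨x, hx, y, hy, rfl⟩ := exists_even_add_odd a
  exact ⟨(⟨x, hx⟩, ⟨y, hy⟩), rfl⟩

theorem HasGaussSign.even_mul_odd [Fintype Γ] [Fintype (evenPart Γ)] [Fintype (oddPart Γ)]
    (hQ : IsQuadratic Q) {s t : ℤ} (hs : HasGaussSign (fun a : evenPart Γ => Q a) s)
    (ht : HasGaussSign (fun a : oddPart Γ => Q a) t) : HasGaussSign Q (s * t) := by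
  have hsum : ∀ j : ℕ, ∑ a, (Q a : ℂ) ^ j =
      (∑ a : evenPart Γ, (Q a : ℂ) ^ j) * ∑ a : oddPart Γ, (Q a : ℂ) ^ j := fun j => by
    rw [Finset.sum_mul_sum, ← Fintype.sum_prod_type']
    refine (Fintype.sum_bijective _ bijective_even_add_odd _ _ fun v => ?_).symm
    rw [map_add_eq Q, assocForm_even_odd hQ v.1.2 v.2.2, mul_one, Units.val_mul, mul_pow]
  obtain ⟨C, hC, h1⟩ := hs
  obtain ⟨D, hD, h2⟩ := ht
  have h3 := hsum 1
  simp only [pow_one] at h3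
  refine ⟨C * D, mul_pos hC hD, ?_⟩
  rw [hsum, h1, h2, h3]
  push_cast; ring

/-- The Gauss sum of Q⁻² is κC times that of Q⁻¹, whose phase is the conjugate of the signature
phase. The positive constant C cancels against the normalisation. -/
theorem partialGaussSum_eq_of_hasGaussSign [Fintype Γ] (hQ : IsNondegQuadratic Q)
    (h2 : ∀ x, 2 • x = 0 → Q x ^ 2 = 1) {r : ZMod 8} (hr : IsSignature Q r) {κ : ℤ}
    (hκ2 : κ ^ 2 = 1) (hκ : HasGaussSign Q κ) (c : GaussDatum Q) :
    partialGaussSum c.q 0 = e (-(r.val : ℝ) / 8) * κ := by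
  rw [c.partialGaussSum_zero hQ h2]
  obtain ⟨C, hC, hsum⟩ := hκ
  have hG := hQ.sum_mul_sum_inv
  have hG2 := hQ.sum_sq_mul_sum_sq_inv 0 fun x hx => by
    rw [hQ.isQuadratic.assoc_zero_left, mul_one, h2 x hx]
  simp only [hQ.isQuadratic.assoc_zero_left, mul_one, Units.val_pow_eq_pow_val] at hG2
  have hconj : ∑ a, (Q a : ℂ)⁻¹ = starRingEnd ℂ (∑ a, (Q a : ℂ)) := by
    rw [map_sum]
    exact Finset.sum_congr rfl fun a _ => hQ.isQuadratic.inv_eq_conj a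
  have hconj2 : ∑ a, ((Q a : ℂ) ^ 2)⁻¹ = κ * C * ∑ a, (Q a : ℂ)⁻¹ := by
    have : ∑ a, ((Q a : ℂ) ^ 2)⁻¹ = starRingEnd ℂ (∑ a, (Q a : ℂ) ^ 2) := by
      rw [map_sum]
      refine Finset.sum_congr rfl fun a _ => ?_
      rw [map_pow, ← hQ.isQuadratic.inv_eq_conj, inv_pow]
    rw [this, hsum, map_mul, map_mul, Complex.conj_ofReal, ← hconj, map_intCast]
  set τ := Nat.card (nsmulAddMonoidHom (α := Γ) 2).ker with hτ
  have hτpos : 0 < τ := Nat.card_pos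
  have hcard : (Nat.card Γ : ℂ) ≠ 0 := Nat.cast_ne_zero.2 Nat.card_pos.ne'
  have hκ2' : (κ : ℂ) ^ 2 = 1 := by exact_mod_cast congrArg (Int.cast (R := ℂ)) hκ2
  -- Compare the absolute squares |Γ| |Γ[2]| and |Γ| of the Gauss sums of Q² and Q.
  have hC2 : (C : ℂ) ^ 2 = τ := by
    rw [hconj2, hsum] at hG2
    have h3 : (κ : ℂ) ^ 2 * (C : ℂ) ^ 2 * ((∑ a, (Q a : ℂ)) * ∑ a, (Q a : ℂ)⁻¹) =
        Nat.card Γ * τ := by rw [← hG2]; ring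
    rw [hκ2', one_mul, hG, mul_comm] at h3
    exact mul_left_cancel₀ hcard h3
  have hC2' : C ^ 2 = τ := by exact_mod_cast hC2
  -- |Γ| = |Γ[2]| |2Γ| and C² = |Γ[2]|.
  have hsqrt : √(Nat.card Γ : ℝ) = C * √(Nat.card (twoMul Γ) : ℝ) := by
    rw [← card_ker_mul_card_twoMul, Nat.cast_mul, ← hτ, Real.sqrt_mul (Nat.cast_nonneg _), ← hC2',
      Real.sqrt_sq hC.le]
  have hs0 : (√(Nat.card (twoMul Γ) : ℝ) : ℂ) ≠ 0 := by
    rw [Complex.ofReal_ne_zero, Real.sqrt_ne_zero']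
    exact_mod_cast Nat.card_pos
  have hC0 : (C : ℂ) ≠ 0 := Complex.ofReal_ne_zero.2 hC.ne'
  have hGval : ∑ a, (Q a : ℂ) = C * √(Nat.card (twoMul Γ) : ℝ) * e ((r.val : ℝ) / 8) := by
    rw [IsSignature, hsqrt, inv_mul_eq_iff_eq_mul₀] at hr
    · rw [hr, Complex.ofReal_mul]
    · rw [Complex.ofReal_mul]; exact mul_ne_zero hC0 hs0
  have hGinv : ∑ a, (Q a : ℂ)⁻¹ = C * √(Nat.card (twoMul Γ) : ℝ) * e (-(r.val : ℝ) / 8) := by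
    rw [hconj, hGval, map_mul, map_mul, Complex.conj_ofReal, Complex.conj_ofReal, conj_e, neg_div]
  rw [hconj2, hGinv, ← hC2]
  field_simp

/-- The value of the partial Gauss sum when `Q²` is trivial on `Γ[2]`. -/
theorem exists_signature_sign [Fintype Γ] (hQ : IsNondegQuadratic Q)
    (h2 : ∀ x, 2 • x = 0 → Q x ^ 2 = 1) :
    ∃ (r : ZMod 8) (s : ℤˣ), IsSignature Q r ∧ IsSign (fun a : evenPart Γ => Q a) s ∧
      ∀ c : GaussDatum Q, (QuotientAddGroup.mk c.δ : Γ ⧸ twoMul Γ) = 0 ∧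
        c.gaussSum = partialGaussSum c.q 0 ∧
        partialGaussSum c.q 0 = e (-(r.val : ℝ) / 8) * ((s : ℤ) : ℂ) *
          ((jacobiSym 2 (Nat.card (oddPart Γ)) : ℤ) : ℂ) := by
  classical
  have := Fintype.ofFinite (evenPart Γ)
  have := Fintype.ofFinite (oddPart Γ)
  have hev := (nondegOn_evenPart hQ).isNondegQuadratic hQ.isQuadratic
  have hodd := (nondegOn_oddPart hQ).isNondegQuadratic hQ.isQuadratic
  obtain ⟨dev⟩ := hev.nonempty_jordanDecomposition
  obtain ⟨dodd⟩ := hodd.nonempty_jordanDecomposition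
  obtain ⟨r, hr⟩ := hQ.exists_isSignature
  have hsign : ∀ d : JordanDecomposition (fun a : evenPart Γ => Q a),
      HasGaussSign (fun a : evenPart Γ => Q a) d.sign := fun d => by
    refine d.hasGaussSign_of_even hev.isQuadratic (fun a => ?_) fun x hx => ?_
    · obtain ⟨k, hk⟩ := a.2
      exact ⟨k, Subtype.ext (by exact_mod_cast hk)⟩
    · exact h2 x (by exact_mod_cast congrArg Subtype.val hx)
  have hJ : HasGaussSign (fun a : oddPart Γ => Q a) (jacobiSym 2 (Nat.card (oddPart Γ))) := by
    refine dodd.hasGaussSign_of_odd hodd.isQuadratic fun a => ?_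
    obtain ⟨n, hn, hna⟩ := a.2
    exact ⟨n, hn, Subtype.ext (by exact_mod_cast hna)⟩
  have hJ2 : jacobiSym 2 (Nat.card (oddPart Γ)) ^ 2 = 1 := by
    refine jacobiSym.sq_one ?_
    have : Nat.Coprime 2 (Nat.card (oddPart Γ)) := by
      rw [Nat.coprime_two_left, ← Nat.not_even_iff_odd, even_iff_two_dvd]
      intro hdvd
      obtain ⟨a, ha⟩ := exists_prime_addOrderOf_dvd_card' 2 hdvd
      obtain ⟨n, hn, hna⟩ := a.2
      have h1 : n • a = 0 := Subtype.ext (by exact_mod_cast hna)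
      have h3 := addOrderOf_dvd_of_nsmul_eq_zero h1
      rw [ha] at h3
      exact Nat.not_even_iff_odd.2 hn (even_iff_two_dvd.2 h3)
    exact_mod_cast this
  refine ⟨r, dev.sign, hr, ⟨⟨dev⟩, fun d => (hsign d).eq hev (hsign dev)⟩, fun c => ?_⟩
  have hδ : (QuotientAddGroup.mk c.δ : Γ ⧸ twoMul Γ) = 0 :=
    (QuotientAddGroup.eq_zero_iff _).2 (c.delta_mem_twoMul hQ h2)
  refine ⟨hδ, by rw [GaussDatum.gaussSum, hδ], ?_⟩
  rw [partialGaussSum_eq_of_hasGaussSign hQ h2 hr ?_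
    (HasGaussSign.even_mul_odd hQ.isQuadratic (hsign dev) hJ) c]
  · push_cast; ring
  · rw [mul_pow, hJ2, mul_one, ← Units.val_pow_eq_pow_val, Int.units_sq, Units.val_one]

end Parts

end DiscForm

/-! ### The main theorem. -/

theorem mainTheorem4 {Γ : Type*} [AddCommGroup Γ] [Fintype Γ] (Q : Γ → ℂˣ)
    (hQ : DiscForm.IsNondegQuadratic Q) :
    Nonempty (DiscForm.GaussDatum Q) ∧
    Nonempty (DiscForm.JordanDecomposition Q) ∧
    ∀ d : DiscForm.JordanDecomposition Q,
      ((∀ c c' : DiscForm.GaussDatum Q, c.gaussSum = c'.gaussSum) ↔ ¬ d.ContainsTwoT) ∧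
      (¬ d.ContainsTwoT →
        ∃ (r : ZMod 8) (s : ℤˣ),
          DiscForm.IsSignature Q r ∧
          DiscForm.IsSign (fun a : DiscForm.evenPart Γ => Q a) s ∧
          ∀ c : DiscForm.GaussDatum Q,
            (QuotientAddGroup.mk c.δ : Γ ⧸ DiscForm.twoMul Γ) = 0 ∧
            c.gaussSum = DiscForm.partialGaussSum c.q 0 ∧
            DiscForm.partialGaussSum c.q 0 =
              DiscForm.e (-(r.val : ℝ) / 8) * ((s : ℤ) : ℂ) *
                ((jacobiSym 2 (Nat.card (DiscForm.oddPart Γ)) : ℤ) : ℂ)) := by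
  obtain ⟨d₀⟩ := hQ.nonempty_jordanDecomposition
  obtain ⟨c₀⟩ := d₀.gaussDatum_exists hQ.isQuadratic
  refine ⟨⟨c₀⟩, ⟨d₀⟩, fun d => ⟨⟨fun h hd => ?_, fun hd c c' => ?_⟩, fun hd => ?_⟩⟩
  · obtain ⟨x, hx, hx'⟩ := d.exists_sq_eq_neg_one hd
    obtain ⟨c', hc'⟩ := DiscForm.exists_gaussSum_ne hQ c₀ x hx
      (fun h1 => DiscForm.neg_one_ne_one_units (hx'.symm.trans h1))
    exact hc' (h c' c₀)
  -- r and s are fixed before the data, so the formula gives every choice the same value.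
  · obtain ⟨r, s, -, -, h⟩ :=
      DiscForm.exists_signature_sign hQ (d.sq_eq_one_of_two_smul hQ.isQuadratic hd)
    rw [(h c).2.1, (h c').2.1, (h c).2.2, (h c').2.2]
  · exact DiscForm.exists_signature_sign hQ (d.sq_eq_one_of_two_smul hQ.isQuadratic hd)
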